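/- Let $\Bbbk$ be an algebraically closed field and let $A$ be a finite-dimensional $\Bbbk$-algebra with a chosen finite complete set of orthogonal primitive idempotents $\{e_\lambda\}_{\lambda\in\Lambda}$, $\sum_{\lambda\in\Lambda} e_\lambda=1$. Put $P_\lambda=Ae_\lambda$ and $S_\lambda=P_\lambda/\operatorname{rad}P_\lambda$, and assume that $A$ is basic, i.e. $P_\lambda\not\cong P_\mu$ for $\lambda\neq\mu$. For a linear order $\preccurlyeq$ on $\Lambda$, let the standard module $\Delta_\lambda$ be the largest quotient of $P_\lambda$ all of whose composition factors $S_\mu$ satisfy $\mu\preccurlyeq\lambda$, and let the proper standard module $\overline{\Delta}_\lambda$ be the largest quotient of $P_\lambda$ all of whose composition factors $S_\mu$ satisfy $\mu\prec\lambda$, except for one copy of $S_\lambda$. The algebra $A$ is properly stratified with respect to $\preccurlyeq$ if the left regular module ${}_AA$ has a finite filtration all of whose factors are isomorphic to modules $\Delta_\lambda$, and also a finite filtration all of whose factors are isomorphic to modules $\overline{\Delta}_\lambda$. The associated category $\mathcal{A}$ of $A$ has objects $e_\lambda$ ($\lambda\in\Lambda$), morphism spaces $\mathcal{A}(e_\lambda,e_\mu)=e_\mu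 Ae_\lambda$, and composition given by multiplication in $A$. It is directed if there is a partial order $\leqslant$ on $\Lambda$ such that $\mathcal{A}(e_\lambda,e_\mu)\neq 0$ implies $\lambda\leqslant\mu$. In that case $J=\bigoplus_{\lambda\neq\mu\in\Lambda}e_\mu Ae_\lambda$ is a two-sided ideal of $A$. Then $A$ is properly stratified with respect to every linear order on $\Lambda$ if and only if $\mathcal{A}$ is directed and $J$ is projective both as a left and as a right $A$-module. -/

import Mathlib

namespace StratAlg

open CategoryTheory

universe u v w

set_option linter.unusedSectionVars false

section Modules

variable (A : Type v) [Ring A]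

/-- A primitive idempotent: a nonzero idempotent which is not the sum of two nonzero orthogonal
idempotents. -/
def IsPrimitiveIdempotent {A : Type v} [Ring A] (e : A) : Prop :=
  IsIdempotentElem e ∧ e ≠ 0 ∧
    ∀ f g : A, IsIdempotentElem f → IsIdempotentElem g → f * g = 0 → g * f = 0 →
      f + g = e → f = 0 ∨ g = 0

/-- `[M : S] = n`: the module `M` has a composition series from `0` to `M` exactly `n` of whose
factors are isomorphic to `S`. (For `M` of finite length, such an `n` exists and is unique by the
Jordan–Hölder theorem.) -/
def HasMultiplicity (M : Type*) [AddCommGroup M] [Module A M]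
    (S : Type*) [AddCommGroup S] [Module A S] (n : ℕ) : Prop :=
  ∃ s : CompositionSeries (Submodule A M), s.head = ⊥ ∧ s.last = ⊤ ∧
    Set.ncard {i : Fin s.length |
      Nonempty ((↥(s i.succ) ⧸ (s i.castSucc).submoduleOf (s i.succ)) ≃ₗ[A] S)} = n

/-- `M` belongs to `F(X)`: it has a finite filtration by submodules, from `0` to `M`, each of whose
factors is isomorphic to some `X i`. -/
def HasFiltrationBy (M : Type*) [AddCommGroup M] [Module A M]
    {ι : Type*} (X : ι → Type*) [∀ i, AddCommGroup (X i)] [∀ i, Module A (X i)] : Prop :=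
  ∃ (n : ℕ) (F : Fin (n + 1) → Submodule A M), Monotone F ∧ F 0 = ⊥ ∧ F (Fin.last n) = ⊤ ∧
    ∀ j : Fin n, ∃ i : ι,
      Nonempty ((↥(F j.succ) ⧸ (F j.castSucc).submoduleOf (F j.succ)) ≃ₗ[A] X i)

end Modules

section Stratification

variable {A : Type v} [Ring A] {Λ : Type w} (e : Λ → A)

/-- The left module `P_l = A e_l`. -/
abbrev ProjMod (l : Λ) : Submodule A A := Submodule.span A {e l}

/-- The module `S_l = P_l / rad P_l`. -/
abbrev SimpleMod (l : Λ) : Type v := ↥(ProjMod e l) ⧸ Module.jacobson A ↥(ProjMod e l)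

/-- `A` is basic, in terms of a complete set of orthogonal primitive idempotents: the modules
`P_l` are pairwise nonisomorphic. -/
def IsBasic : Prop :=
  ∀ l m : Λ, l ≠ m → IsEmpty (↥(ProjMod e l) ≃ₗ[A] ↥(ProjMod e m))

variable [LinearOrder Λ]

/-- The least submodule `N` of `P_l` such that every composition factor `S_m` of `P_l / N`
satisfies `m ≤ l`. -/
def standardKer (l : Λ) : Submodule A ↥(ProjMod e l) :=
  sInf {N | ∀ m : Λ, ¬ m ≤ l → HasMultiplicity A (↥(ProjMod e l) ⧸ N) (SimpleMod e m) 0}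

/-- The standard module: the largest quotient of `P_l` all of whose composition
factors `S_m` satisfy `m ≤ l`. -/
abbrev StandardMod (l : Λ) : Type v := ↥(ProjMod e l) ⧸ standardKer e l

/-- The least submodule `N` of `P_l` such that every composition factor `S_m` of `P_l / N`
satisfies `m < l`, except for one copy of `S_l`. -/
def properStandardKer (l : Λ) : Submodule A ↥(ProjMod e l) :=
  sInf {N | HasMultiplicity A (↥(ProjMod e l) ⧸ N) (SimpleMod e l) 1 ∧
    ∀ m : Λ, m ≠ l → ¬ m < l → HasMultiplicity A (↥(ProjMod e l) ⧸ N) (SimpleMod e m) 0}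

/-- The proper standard module: the largest quotient of `P_l` all of whose composition
factors `S_m` satisfy `m < l`, except for one copy of `S_l`. -/
abbrev ProperStandardMod (l : Λ) : Type v := ↥(ProjMod e l) ⧸ properStandardKer e l

/-- `A` is properly stratified with respect to the given linear order on `Λ`: the left regular
module has a filtration by standard modules and a filtration by proper standard modules. -/
def IsProperlyStratified : Prop :=
  HasFiltrationBy A A (StandardMod e) ∧ HasFiltrationBy A A (ProperStandardMod e)

end Stratification

/-- A category with zero morphisms is directed if there is a partial order on its
objects such that `X ≤ Y` whenever there is a nonzero morphism from `X` to `Y`. -/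
def IsDirectedCategory (C : Type*) [Category C] [Limits.HasZeroMorphisms C] : Prop :=
  ∃ r : C → C → Prop, IsPartialOrder C r ∧ ∀ (X Y : C) (f : X ⟶ Y), f ≠ 0 → r X Y

section AssociatedCategory

variable (k : Type u) [Field k] {A : Type v} [Ring A] [Algebra k A] {Λ : Type w} [Fintype Λ]

/-- The subspace `e_m A e_l` of `A`. -/
def peirce (e : Λ → A) (l m : Λ) : Submodule k A :=
  LinearMap.range (LinearMap.mulLeft k (e m) ∘ₗ LinearMap.mulRight k (e l))

theorem mem_peirce {e : Λ → A} {l m : Λ} {x : A} :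
    x ∈ peirce k e l m ↔ ∃ a : A, e m * (a * e l) = x := by
  simp [peirce, LinearMap.mem_range]

/-- The objects of the associated category: one object for each idempotent `e_l`. -/
@[ext]
structure AssocCat (k : Type u) [Field k] {A : Type v} [Ring A] [Algebra k A] {Λ : Type w}
    [Fintype Λ] {e : Λ → A} (he : CompleteOrthogonalIdempotents e) where
  /-- The index of the object. -/
  idx : Λ

variable {e : Λ → A} (he : CompleteOrthogonalIdempotents e)

theorem e_mul_of_mem {l m : Λ} {x : A} (he : CompleteOrthogonalIdempotents e)
    (hx : x ∈ peirce k e l m) : e m * x = x := by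
  obtain ⟨a, rfl⟩ := (mem_peirce k).1 hx
  rw [← mul_assoc, (he.idem m).eq]

theorem mul_e_of_mem {l m : Λ} {x : A} (he : CompleteOrthogonalIdempotents e)
    (hx : x ∈ peirce k e l m) : x * e l = x := by
  obtain ⟨a, rfl⟩ := (mem_peirce k).1 hx
  rw [mul_assoc, mul_assoc, (he.idem l).eq]

theorem mul_mem_peirce {l m n : Λ} {x y : A} (hx : x ∈ peirce k e l m)
    (hy : y ∈ peirce k e m n) : y * x ∈ peirce k e l n := by
  obtain ⟨a, rfl⟩ := (mem_peirce k).1 hx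
  obtain ⟨b, rfl⟩ := (mem_peirce k).1 hy
  exact (mem_peirce k).2 ⟨b * e m * (e m * a), by simp only [mul_assoc]⟩

theorem e_mem_peirce (he : CompleteOrthogonalIdempotents e) (l : Λ) : e l ∈ peirce k e l l :=
  (mem_peirce k).2 ⟨1, by rw [one_mul, (he.idem l).eq]⟩

/-- The associated category of `A`: morphisms from `e_l` to `e_m` are the elements of `e_m A e_l`,
and composition is multiplication in `A`, from right to left. -/
instance : Category (AssocCat k he) where
  Hom X Y := ↥(peirce k e X.idx Y.idx)
  id X := ⟨e X.idx, e_mem_peirce k he X.idx⟩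
  comp f g := ⟨(g : A) * (f : A), mul_mem_peirce (e := e) k f.2 g.2⟩
  id_comp f := Subtype.ext (mul_e_of_mem (e := e) k he f.2)
  comp_id f := Subtype.ext (e_mul_of_mem (e := e) k he f.2)
  assoc _ _ _ := Subtype.ext (mul_assoc _ _ _).symm

instance : Preadditive (AssocCat k he) where
  homGroup X Y := inferInstanceAs (AddCommGroup ↥(peirce k e X.idx Y.idx))
  add_comp _ _ _ _ _ _ := Subtype.ext (mul_add _ _ _)
  comp_add _ _ _ _ _ _ := Subtype.ext (add_mul _ _ _)

instance : Linear k (AssocCat k he) where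
  homModule X Y := inferInstanceAs (Module k ↥(peirce k e X.idx Y.idx))
  smul_comp _ _ _ _ _ _ := Subtype.ext (mul_smul_comm _ _ _)
  comp_smul _ _ _ _ _ _ := Subtype.ext (smul_mul_assoc _ _ _)

/-- The subspace `J = ⨁_{l ≠ m} e_m A e_l` of `A`. -/
def offDiag (e : Λ → A) : Submodule k A :=
  ⨆ (l : Λ) (m : Λ) (_ : l ≠ m), peirce k e l m

variable {k} {he}

theorem peirce_le_offDiag {l m : Λ} (h : l ≠ m) : peirce k e l m ≤ offDiag k e :=
  le_iSup_of_le l (le_iSup_of_le m (le_iSup_of_le h le_rfl))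

theorem offDiag_le {p : Submodule k A} (h : ∀ l m : Λ, l ≠ m → peirce k e l m ≤ p) :
    offDiag k e ≤ p :=
  iSup_le fun l => iSup_le fun m => iSup_le fun hlm => h l m hlm

theorem mul_eq_zero_of_isDirected (hd : IsDirectedCategory (AssocCat k he)) {l m : Λ} (h : l ≠ m)
    {x y : A} (hx : x ∈ peirce k e l m) (hy : y ∈ peirce k e m l) : y * x = 0 := by
  obtain ⟨r, hr, H⟩ := hd
  by_contra hne
  have hx0 : x ≠ 0 := by rintro rfl; simp at hne
  have hy0 : y ≠ 0 := by rintro rfl; simp at hne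
  have h1 := H ⟨l⟩ ⟨m⟩ ⟨x, hx⟩ (fun h0 => hx0 (congrArg Subtype.val h0))
  have h2 := H ⟨m⟩ ⟨l⟩ ⟨y, hy⟩ (fun h0 => hy0 (congrArg Subtype.val h0))
  exact h (congrArg AssocCat.idx (hr.antisymm _ _ h1 h2))

theorem mul_mem_offDiag_left (hd : IsDirectedCategory (AssocCat k he)) (a : A) {x : A}
    (hx : x ∈ offDiag k e) : a * x ∈ offDiag k e := by
  suffices H : offDiag k e ≤ (offDiag k e).comap (LinearMap.mulLeft k a) from H hx
  refine offDiag_le fun l m hlm y hy => ?_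
  have hy' : a * y = ∑ n, e n * (a * e m) * y := by
    rw [← Finset.sum_mul, ← Finset.sum_mul, he.complete, one_mul, mul_assoc,
      e_mul_of_mem k he hy]
  rw [Submodule.mem_comap, LinearMap.mulLeft_apply, hy']
  refine Submodule.sum_mem _ fun n _ => ?_
  have hz : e n * (a * e m) ∈ peirce k e m n := (mem_peirce k).2 ⟨a, rfl⟩
  by_cases hn : l = n
  · subst hn
    rw [mul_eq_zero_of_isDirected hd hlm hy hz]
    exact Submodule.zero_mem _
  · exact peirce_le_offDiag hn (mul_mem_peirce k hy hz)

theorem mul_mem_offDiag_right (hd : IsDirectedCategory (AssocCat k he)) (a : A) {x : A}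
    (hx : x ∈ offDiag k e) : x * a ∈ offDiag k e := by
  suffices H : offDiag k e ≤ (offDiag k e).comap (LinearMap.mulRight k a) from H hx
  refine offDiag_le fun l m hlm y hy => ?_
  have hy' : y * a = ∑ n, y * (e l * (a * e n)) := by
    rw [← Finset.mul_sum, ← Finset.mul_sum, ← Finset.mul_sum, he.complete, mul_one, ← mul_assoc,
      mul_e_of_mem k he hy]
  rw [Submodule.mem_comap, LinearMap.mulRight_apply, hy']
  refine Submodule.sum_mem _ fun n _ => ?_
  have hz : e l * (a * e n) ∈ peirce k e n l := (mem_peirce k).2 ⟨a, rfl⟩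
  by_cases hn : n = m
  · subst hn
    rw [mul_eq_zero_of_isDirected hd (Ne.symm hlm) hz hy]
    exact Submodule.zero_mem _
  · exact peirce_le_offDiag hn (mul_mem_peirce k hz hy)

/-- `J` as a left `A`-module, when the associated category is directed. -/
def leftJ (hd : IsDirectedCategory (AssocCat k he)) : Submodule A A where
  carrier := offDiag k e
  add_mem' := (offDiag k e).add_mem
  zero_mem' := (offDiag k e).zero_mem
  smul_mem' a _ hx := mul_mem_offDiag_left hd a hx

/-- `J` as a right `A`-module (a left module over the opposite ring), when the associated category
is directed. -/
def rightJ (hd : IsDirectedCategory (AssocCat k he)) : Submodule Aᵐᵒᵖ A where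
  carrier := offDiag k e
  add_mem' := (offDiag k e).add_mem
  zero_mem' := (offDiag k e).zero_mem
  smul_mem' a _ hx := mul_mem_offDiag_right hd a.unop hx

end AssociatedCategory

end StratAlg

/-! Since `k` is algebraically closed, `[M : S_l] = dim e_l M` (`hasMultiplicity_iff`). The kernel
of `P_l → Δ_l` is generated by the spaces `e_m P_l`, `m > l`; for the proper standard module `Δ̄_l`
the nilpotent elements of `e_l A e_l` are added (`standardKer_eq`, `properStandardKer_eq`). After
that the proof consists of traces of idempotents (`genBy`) and dimension counts.

From stratification to `J`, each conclusion comes from a suitable order. With `l` greatest, `A e_l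
A` is projective; if `e_l A e_m ≠ 0`, then `P_l` is a summand of `A e_l A e_m ⊆ P_m`. Mutual
embeddings are excluded by dimension and basicness, so the category is directed. With `μ` least and
the directed order reversed elsewhere, `Δ_κ = P_κ` for `κ ≠ μ`, so the trace of these projectives in
`A` is projective; `J e_μ` is a retract of it (`projective_leftJ`). With `ν` least and the directed
order kept elsewhere, `Δ̄_κ` with `κ ≠ ν` occurs `dim e_κ A` times in `A`, whence `dim e_ν J = ∑ c_κ
dim e_κ A` with `c_κ = dim e_ν Δ̄_κ`. By Nakayama, lifted bases of the spaces `e_ν Δ̄_κ` give a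
surjection of right modules `⨁ (e_κ A)^{c_κ} → e_ν J`, an isomorphism by dimension
(`projective_rightJ`).

Conversely, directedness gives `e_l A e_m A e_l = 0` for `m ≠ l`, and `J e_l` is a projective module
smaller than `P_l`. Claims compatible with split extensions thus reduce from `P_l` to `J e_l`
(`projective_induction`). For left modules this yields the standard filtration. Over the opposite
algebra it yields `dim Δ_l = dim (e_l A e_l) * dim Δ̄_l`. Now `Δ_l` has a filtration of length `dim
e_l Δ_l = dim e_l A e_l` by quotients of `Δ̄_l`, and the equality of dimensions forces each factor
to be `Δ̄_l` itself. -/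

namespace StratAlg

universe u v w

/-! ### Dimensions of idempotent parts of modules -/

section CornerDim

variable (k : Type u) [Field k] {A : Type v} [Ring A] [Algebra k A]
  {M : Type*} [AddCommGroup M] [Module A M] [Module k M] [IsScalarTower k A M]
  {M' : Type*} [AddCommGroup M'] [Module A M'] [Module k M'] [IsScalarTower k A M']

theorem finite_submodule [FiniteDimensional k M] (N : Submodule A M) : FiniteDimensional k ↥N :=
  Module.Finite.of_injective (N.subtype.restrictScalars k) N.subtype_injective

theorem finite_quotient [FiniteDimensional k M] (N : Submodule A M) :
    FiniteDimensional k (M ⧸ N) :=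
  Module.Finite.of_surjective (N.mkQ.restrictScalars k) N.mkQ_surjective

theorem finrank_quotient_add [FiniteDimensional k M] (N : Submodule A M) :
    Module.finrank k (M ⧸ N) + Module.finrank k ↥N = Module.finrank k M :=
  Submodule.finrank_quotient_add_finrank (N.restrictScalars k)

variable (M) in
/-- The subspace of vectors of `M` fixed by `f`; this is `f • M` for an idempotent `f`. -/
def fixedBy (f : A) : Submodule k M where
  carrier := {x | f • x = x}
  add_mem' {x y} hx hy := by
    simp only [Set.mem_ofPred_eq] at *
    rw [smul_add, hx, hy]
  zero_mem' := smul_zero f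
  smul_mem' c x hx := by
    simp only [Set.mem_ofPred_eq] at *
    rw [← smul_one_smul A c x, ← mul_smul, mul_smul_comm, mul_one, smul_assoc, hx, smul_one_smul]

@[simp]
theorem mem_fixedBy {f : A} {x : M} : x ∈ fixedBy k M f ↔ f • x = x := Iff.rfl

variable (M) in
/-- The dimension of `f • M`, for an idempotent `f`. -/
noncomputable def cornerDim (f : A) : ℕ := Module.finrank k ↥(fixedBy k M f)

theorem cornerDim_congr (φ : M ≃ₗ[A] M') (f : A) : cornerDim k M f = cornerDim k M' f := by
  refine LinearEquiv.finrank_eq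
    ((φ.restrictScalars k).ofSubmodules (fixedBy k M f) (fixedBy k M' f) ?_)
  ext y
  simp only [Submodule.mem_map, mem_fixedBy]
  constructor
  · rintro ⟨x, hx, rfl⟩
    simp only [LinearEquiv.coe_coe, LinearEquiv.restrictScalars_apply]
    rw [← map_smul, hx]
  · intro hy
    exact ⟨φ.symm y, by rw [← map_smul, hy], by simp⟩

/-- Multiplication by an idempotent is exact: if `x` lifts a vector fixed by `f`, then `f • x` is a
fixed lift. -/
theorem cornerDim_add {f : A} (hf : IsIdempotentElem f) [FiniteDimensional k M]
    (N : Submodule A M) : cornerDim k M f = cornerDim k ↥N f + cornerDim k (M ⧸ N) f := by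
  let φ : ↥(fixedBy k M f) →ₗ[k] ↥(fixedBy k (M ⧸ N) f) :=
    (N.mkQ.restrictScalars k).restrict fun x hx => by
      simp only [mem_fixedBy, LinearMap.restrictScalars_apply] at hx ⊢
      rw [← map_smul, hx]
  have hsurj : Function.Surjective φ := by
    rintro ⟨y, hy⟩
    obtain ⟨x, rfl⟩ := N.mkQ_surjective y
    refine ⟨⟨f • x, ?_⟩, Subtype.ext ?_⟩
    · rw [mem_fixedBy, ← mul_smul, hf.eq]
    · rw [mem_fixedBy, ← map_smul] at hy
      exact hy
  let ψ : ↥(fixedBy k ↥N f) →ₗ[k] ↥(fixedBy k M f) :=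
    (N.subtype.restrictScalars k).restrict fun x hx => congrArg Subtype.val hx
  have hψ : Function.Injective ψ := fun x y h =>
    Subtype.ext (Subtype.ext (congrArg (fun z : ↥(fixedBy k M f) => (z : M)) h))
  have hker : LinearMap.ker φ = LinearMap.range ψ := by
    ext ⟨x, hx⟩
    constructor
    · intro h
      have h1 : N.mkQ x = 0 := congrArg Subtype.val (LinearMap.mem_ker.1 h)
      rw [Submodule.mkQ_apply, Submodule.Quotient.mk_eq_zero] at h1
      exact ⟨⟨⟨x, h1⟩, Subtype.ext hx⟩, rfl⟩
    · rintro ⟨⟨⟨y, hy⟩, hy'⟩, h⟩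
      have : y = x := congrArg Subtype.val h
      subst this
      exact LinearMap.mem_ker.2 (Subtype.ext ((Submodule.Quotient.mk_eq_zero N).2 hy))
  have h := LinearMap.finrank_range_add_finrank_ker φ
  rw [LinearMap.range_eq_top.2 hsurj, finrank_top, hker, LinearMap.finrank_range_of_inj hψ] at h
  rw [cornerDim, cornerDim, cornerDim, ← h, add_comm]

theorem cornerDim_eq_zero_iff {f : A} (hf : IsIdempotentElem f) [FiniteDimensional k M] :
    cornerDim k M f = 0 ↔ ∀ x : M, f • x = 0 := by
  rw [cornerDim, Submodule.finrank_eq_zero, Submodule.eq_bot_iff]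
  refine ⟨fun h x => h _ ?_, fun h x hx => ?_⟩
  · rw [mem_fixedBy, ← mul_smul, hf.eq]
  · rw [← (mem_fixedBy k).1 hx, h]

/-- Lets a submodule be exchanged for another with the same `f`-part, such as a trace for the
radical. -/
theorem cornerDim_sub_eq {f : A} (N N' : Submodule A M) (h : ∀ x, f • x = x → (x ∈ N ↔ x ∈ N')) :
    cornerDim k ↥N f = cornerDim k ↥N' f := by
  have key : ∀ N : Submodule A M, cornerDim k ↥N f =
      Module.finrank k ↥(fixedBy k M f ⊓ N.restrictScalars k) := by
    intro N
    rw [cornerDim]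
    have e1 : (fixedBy k ↥N f).map (N.subtype.restrictScalars k) =
        fixedBy k M f ⊓ N.restrictScalars k := by
      ext x
      constructor
      · rintro ⟨y, hy, rfl⟩
        exact ⟨congrArg Subtype.val hy, y.2⟩
      · rintro ⟨hx, hx'⟩
        exact ⟨⟨x, hx'⟩, Subtype.ext hx, rfl⟩
    rw [← e1]
    exact LinearEquiv.finrank_eq (Submodule.equivMapOfInjective
      (N.subtype.restrictScalars k) N.subtype_injective _)
  have h2 : fixedBy k M f ⊓ N.restrictScalars k = fixedBy k M f ⊓ N'.restrictScalars k := by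
    ext x
    simp only [Submodule.mem_inf, Submodule.restrictScalars_mem, mem_fixedBy]
    exact and_congr_right fun hx => h x hx
  rw [key, key, h2]

end CornerDim

/-! ### Submodules generated by the action of a set (traces of idempotents) -/

section GenBy

variable {A : Type v} [Ring A] {M : Type*} [AddCommGroup M] [Module A M]
  {M' : Type*} [AddCommGroup M'] [Module A M']

/-- The submodule generated by the products `s • x` with `s ∈ S` and `x ∈ N`. -/
def genBy (S : Set A) (N : Submodule A M) : Submodule A M :=
  Submodule.span A {y | ∃ s ∈ S, ∃ x ∈ N, s • x = y}

theorem smul_mem_genBy {S : Set A} {N : Submodule A M} {s : A} (hs : s ∈ S) {x : M} (hx : x ∈ N) :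
    s • x ∈ genBy S N :=
  Submodule.subset_span ⟨s, hs, x, hx, rfl⟩

theorem genBy_le {S : Set A} {N L : Submodule A M} (h : ∀ s ∈ S, ∀ x ∈ N, s • x ∈ L) :
    genBy S N ≤ L :=
  Submodule.span_le.2 (by rintro _ ⟨s, hs, x, hx, rfl⟩; exact h s hs x hx)

theorem genBy_le_self (S : Set A) (N : Submodule A M) : genBy S N ≤ N :=
  genBy_le fun s _ _ hx => N.smul_mem s hx

theorem genBy_mono {S S' : Set A} {N N' : Submodule A M} (hS : S ⊆ S') (hN : N ≤ N') :
    genBy S N ≤ genBy S' N' :=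
  genBy_le fun _ hs _ hx => smul_mem_genBy (hS hs) (hN hx)

theorem map_genBy (S : Set A) (N : Submodule A M) (f : M →ₗ[A] M') :
    (genBy S N).map f = genBy S (N.map f) := by
  apply le_antisymm
  · rw [Submodule.map_le_iff_le_comap]
    refine genBy_le fun s hs x hx => ?_
    rw [Submodule.mem_comap, map_smul]
    exact smul_mem_genBy hs (Submodule.mem_map_of_mem hx)
  · refine genBy_le ?_
    rintro s hs _ ⟨x, hx, rfl⟩
    rw [← map_smul]
    exact Submodule.mem_map_of_mem (smul_mem_genBy hs hx)

theorem map_subtype_genBy_top (S : Set A) (N : Submodule A M) :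
    (genBy S (⊤ : Submodule A ↥N)).map N.subtype = genBy S N := by
  rw [map_genBy, Submodule.map_subtype_top]

/-- Generation inside a submodule agrees with generation in the ambient module. -/
noncomputable def genByTopEquiv (S : Set A) (N : Submodule A M) :
    ↥(genBy S (⊤ : Submodule A ↥N)) ≃ₗ[A] ↥(genBy S N) :=
  (Submodule.equivMapOfInjective N.subtype N.subtype_injective _).trans
    (LinearEquiv.ofEq _ _ (map_subtype_genBy_top S N))

end GenBy

/-! ### The local modules `A f` for primitive idempotents `f` -/

section Local

variable {k : Type u} [Field k] {A : Type v} [Ring A] [Algebra k A] [FiniteDimensional k A]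

theorem mem_span_idem {f : A} (hf : IsIdempotentElem f) {x : A} :
    x ∈ Submodule.span A {f} ↔ x * f = x := by
  rw [Submodule.mem_span_singleton]
  constructor
  · rintro ⟨a, rfl⟩
    rw [smul_eq_mul, mul_assoc, hf.eq]
  · intro h
    exact ⟨x, h⟩

variable {M : Type*} [AddCommGroup M] [Module A M]

/-- The homomorphism `A f → M`, `a ↦ a x`. -/
def evalAt (f : A) (x : M) : ↥(Submodule.span A {f}) →ₗ[A] M :=
  (LinearMap.toSpanSingleton A M x) ∘ₗ (Submodule.span A {f}).subtype

@[simp]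
theorem evalAt_apply (f : A) (x : M) (p : ↥(Submodule.span A {f})) :
    evalAt f x p = (p : A) • x := rfl

/-- The generator of `A f`. -/
def gen (f : A) : ↥(Submodule.span A {f}) := ⟨f, Submodule.mem_span_singleton_self f⟩

@[simp]
theorem coe_gen (f : A) : (gen f : A) = f := rfl

theorem smul_gen {f : A} (hf : IsIdempotentElem f) (p : ↥(Submodule.span A {f})) :
    (p : A) • gen f = p :=
  Subtype.ext ((mem_span_idem hf).1 p.2)

theorem projective_span_idem {f : A} (hf : IsIdempotentElem f) :
    Module.Projective A ↥(Submodule.span A {f}) :=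
  Module.Projective.of_split (M := A) (Submodule.span A {f}).subtype
    (LinearMap.toSpanSingleton A _ (gen f)) (by
      ext p
      exact (mem_span_idem hf).1 p.2)

end Local

attribute [local instance] finite_submodule finite_quotient

section Local

variable (k : Type u) [Field k] {A : Type v} [Ring A] [Algebra k A] [FiniteDimensional k A]

theorem evalAt_pow (f : A) (x : ↥(Submodule.span A {f})) (n : ℕ) :
    ((((evalAt f x : Module.End A ↥(Submodule.span A {f})) ^ n) (gen f) :
      ↥(Submodule.span A {f})) : A) = f * (x : A) ^ n := by
  induction n with
  | zero => simp
  | succ n ih =>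
    rw [pow_succ', Module.End.mul_apply, evalAt_apply, Submodule.coe_smul, ih, smul_eq_mul,
      pow_succ, mul_assoc]

include k in
/-- Fitting's lemma for `A f`, `f` a primitive idempotent. -/
theorem isNilpotent_or_bijective {f : A} (hf : IsPrimitiveIdempotent f)
    (φ : Module.End A ↥(Submodule.span A {f})) : IsNilpotent φ ∨ Function.Bijective φ := by
  have : IsNoetherian A ↥(Submodule.span A {f}) := isNoetherian_of_tower k inferInstance
  have : IsArtinian A ↥(Submodule.span A {f}) := isArtinian_of_tower k inferInstance
  obtain ⟨n, hn, hn1⟩ := (φ.eventually_isCompl_ker_pow_range_pow.and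
    (Filter.eventually_ge_atTop 1)).exists
  set U := LinearMap.ker (φ ^ n)
  set W := LinearMap.range (φ ^ n)
  -- The components of the generator in the Fitting decomposition are orthogonal idempotents with
  -- sum `f`, so primitivity makes one of them vanish.
  obtain ⟨u, hu, w, hw, huw⟩ : ∃ u ∈ U, ∃ w ∈ W, u + w = gen f :=
    Submodule.mem_sup.1 (hn.sup_eq_top ▸ Submodule.mem_top)
  have hsplit : ∀ u' ∈ U, ∀ w' ∈ W, ∀ u'' ∈ U, ∀ w'' ∈ W, u' + w' = u'' + w'' →
      u' = u'' ∧ w' = w'' := by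
    intro u' hu' w' hw' u'' hu'' w'' hw'' h
    have h1 : u' - u'' = w'' - w' := by
      rw [sub_eq_sub_iff_add_eq_add, h, add_comm]
    have h2 : u' - u'' = 0 := by
      have := Submodule.mem_inf.2 ⟨U.sub_mem hu' hu'', h1 ▸ W.sub_mem hw'' hw'⟩
      rwa [hn.inf_eq_bot, Submodule.mem_bot] at this
    refine ⟨sub_eq_zero.1 h2, ?_⟩
    rw [h2] at h1
    exact (sub_eq_zero.1 h1.symm).symm
  have hdec : ∀ x : ↥(Submodule.span A {f}), (x : A) • u + (x : A) • w = x := by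
    intro x
    rw [← smul_add, huw, smul_gen hf.1]
  have hu1 := hsplit _ (U.smul_mem (u : A) hu) _ (W.smul_mem (u : A) hw) u hu 0 W.zero_mem
    (by rw [hdec, add_zero])
  have hw1 := hsplit _ (U.smul_mem (w : A) hu) _ (W.smul_mem (w : A) hw) 0 U.zero_mem w hw
    (by rw [hdec, zero_add])
  rcases hf.2.2 (u : A) (w : A) (congrArg Subtype.val hu1.1) (congrArg Subtype.val hw1.2)
    (congrArg Subtype.val hu1.2) (congrArg Subtype.val hw1.1) (congrArg Subtype.val huw) with h | h
  · right
    have hu0 : u = 0 := Subtype.ext h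
    have hW : W = ⊤ := by
      rw [eq_top_iff]
      intro x _
      rw [← hdec x, hu0, smul_zero, zero_add]
      exact W.smul_mem _ hw
    have hsurj : Function.Surjective φ := by
      rw [← LinearMap.range_eq_top, eq_top_iff, ← hW]
      obtain ⟨m, rfl⟩ : ∃ m, n = m + 1 := ⟨n - 1, by omega⟩
      rintro _ ⟨x, rfl⟩
      rw [pow_succ']
      exact ⟨_, rfl⟩
    exact IsNoetherian.bijective_of_surjective_endomorphism φ hsurj
  · left
    have hw0 : w = 0 := Subtype.ext h
    refine ⟨n, LinearMap.ker_eq_top.1 ?_⟩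
    rw [eq_top_iff]
    intro x _
    change x ∈ U
    rw [← hdec x, hw0, smul_zero, add_zero]
    exact U.smul_mem _ hu

include k in
/-- `A f` is a local module for a primitive idempotent `f`. -/
theorem eq_top_or_eq_top_of_sup_eq_top {f : A} (hf : IsPrimitiveIdempotent f)
    {N L : Submodule A ↥(Submodule.span A {f})} (h : N ⊔ L = ⊤) : N = ⊤ ∨ L = ⊤ := by
  obtain ⟨n, hn, l, hl, hnl⟩ : ∃ n ∈ N, ∃ l ∈ L, n + l = gen f :=
    Submodule.mem_sup.1 (h ▸ Submodule.mem_top)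
  have htop : ∀ (Q : Submodule A ↥(Submodule.span A {f})) (x), x ∈ Q →
      Function.Surjective (evalAt f x) → Q = ⊤ := by
    intro Q x hx hs
    rw [eq_top_iff]
    intro y _
    obtain ⟨z, rfl⟩ := hs y
    exact Q.smul_mem _ hx
  -- Right multiplications by `n` and by `l` add up to the identity; if the first is nilpotent, the
  -- second is invertible.
  rcases isNilpotent_or_bijective k hf (evalAt f n) with h1 | h1
  · right
    refine htop L l hl ?_
    have h2 : evalAt f l = 1 - evalAt f n := by
      refine LinearMap.ext fun x => ?_
      rw [LinearMap.sub_apply, evalAt_apply, evalAt_apply, Module.End.one_apply, eq_sub_iff_add_eq,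
        ← smul_add, add_comm, hnl, smul_gen hf.1]
    have h3 : IsUnit (evalAt f l : Module.End A ↥(Submodule.span A {f})) := by
      rw [h2]
      exact h1.isUnit_one_sub
    exact ((Module.End.isUnit_iff _).1 h3).2
  · left
    exact htop N n hn h1.2

variable {k} {f : A}

theorem nontrivial_span (hf : IsPrimitiveIdempotent f) : Nontrivial ↥(Submodule.span A {f}) :=
  ⟨gen f, 0, fun h => hf.2.1 (congrArg Subtype.val h)⟩

include k in
theorem jacobson_span_ne_top (hf : IsPrimitiveIdempotent f) :
    Module.jacobson A ↥(Submodule.span A {f}) ≠ ⊤ := by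
  have := nontrivial_span hf
  have : IsNoetherian A ↥(Submodule.span A {f}) := isNoetherian_of_tower k inferInstance
  exact (Module.jacobson_lt_top A _).ne

include k in
theorem le_jacobson_of_ne_top (hf : IsPrimitiveIdempotent f)
    {N : Submodule A ↥(Submodule.span A {f})} (hN : N ≠ ⊤) :
    N ≤ Module.jacobson A ↥(Submodule.span A {f}) := by
  refine le_sInf fun L hL => ?_
  by_contra h
  rcases eq_top_or_eq_top_of_sup_eq_top k hf (hL.2 (N ⊔ L) (right_lt_sup.2 h)) with h1 | h1
  · exact hN h1
  · exact hL.1 h1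

include k in
theorem isCoatom_jacobson_span (hf : IsPrimitiveIdempotent f) :
    IsCoatom (Module.jacobson A ↥(Submodule.span A {f})) := by
  refine ⟨jacobson_span_ne_top (k := k) hf, fun N hN => ?_⟩
  by_contra h
  exact hN.not_ge (le_jacobson_of_ne_top (k := k) hf h)

include k in
theorem gen_notMem_jacobson (hf : IsPrimitiveIdempotent f) :
    gen f ∉ Module.jacobson A ↥(Submodule.span A {f}) := by
  intro h
  refine jacobson_span_ne_top (k := k) hf (eq_top_iff.2 fun x _ => ?_)
  rw [← smul_gen hf.1 x]
  exact Submodule.smul_mem _ _ h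

include k in
/-- For `x ∈ f A f`, membership in the radical of `A f` means nilpotency. -/
theorem mem_jacobson_iff_isNilpotent (hf : IsPrimitiveIdempotent f)
    {x : ↥(Submodule.span A {f})} (hx : f * (x : A) = x) :
    x ∈ Module.jacobson A ↥(Submodule.span A {f}) ↔ IsNilpotent (x : A) := by
  constructor
  · intro h
    rcases isNilpotent_or_bijective k hf (evalAt f x) with ⟨n, hn⟩ | h1
    -- Nilpotency of right multiplication only yields `f * x ^ n = 0`; one more factor `x = f * x`
    -- absorbs the idempotent.
    · refine ⟨n + 1, ?_⟩
      have := evalAt_pow f x n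
      rw [hn] at this
      rw [pow_succ', ← hx, mul_assoc, (show (x : A) * (f * x) ^ n = (x : A) ^ (n + 1) by
        rw [hx, pow_succ']), pow_succ, ← mul_assoc, ← this]
      simp
    · exfalso
      refine gen_notMem_jacobson (k := k) hf ?_
      obtain ⟨y, hy⟩ := h1.2 (gen f)
      rw [← hy]
      exact Submodule.smul_mem _ _ h
  · rintro ⟨n, hn⟩
    by_contra h
    have h1 : Submodule.span A {x} = ⊤ := by
      by_contra h2
      exact h (le_jacobson_of_ne_top (k := k) hf h2 (Submodule.mem_span_singleton_self x))
    have h2 : Function.Surjective (evalAt f x) := by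
      intro y
      obtain ⟨a, ha⟩ := Submodule.mem_span_singleton.1 (h1 ▸ Submodule.mem_top : y ∈ _)
      refine ⟨a • gen f, ?_⟩
      rw [map_smul, ← ha, evalAt_apply]
      congr 1
      exact Subtype.ext hx
    have h3 : Function.Surjective ((evalAt f x : Module.End A ↥(Submodule.span A {f})) ^ n) := by
      rw [Module.End.coe_pow]
      exact h2.iterate n
    obtain ⟨y, hy⟩ := h3 (gen f)
    have h4 : ((evalAt f x : Module.End A ↥(Submodule.span A {f})) ^ n) = 0 := by
      ext z
      rw [← smul_gen hf.1 z, map_smul, Submodule.coe_smul, evalAt_pow f x n, hn]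
      simp
    rw [h4] at hy
    exact hf.2.1 (congrArg Subtype.val hy).symm

variable {M : Type*} [AddCommGroup M] [Module A M]

include k in
/-- A projective module with a simple quotient not annihilated by `f` has `A f` as a quotient. -/
theorem exists_surjective_of_notMem (hf : IsPrimitiveIdempotent f) [Module.Projective A M]
    {N : Submodule A M} (hN : IsCoatom N) {x : M} (hx : f • x ∉ N) :
    ∃ φ : M →ₗ[A] ↥(Submodule.span A {f}), Function.Surjective φ := by
  have hs : IsSimpleModule A (M ⧸ N) := isSimpleModule_iff_isCoatom.2 hN
  let g : ↥(Submodule.span A {f}) →ₗ[A] M ⧸ N := evalAt f (N.mkQ x)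
  have hg0 : g (gen f) ≠ 0 := by
    intro h
    refine hx ((Submodule.Quotient.mk_eq_zero N).1 ?_)
    exact h
  have hg : Function.Surjective g := by
    refine LinearMap.surjective_of_ne_zero fun h => hg0 ?_
    rw [h, LinearMap.zero_apply]
  obtain ⟨φ, hφ⟩ := Module.projective_lifting_property g N.mkQ hg
  refine ⟨φ, LinearMap.range_eq_top.1 ?_⟩
  -- The range of the lift supplements the proper submodule `ker g`, hence is everything because `A
  -- f` is local.
  have hsup : LinearMap.range φ ⊔ LinearMap.ker g = ⊤ := by
    rw [eq_top_iff]
    intro p _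
    obtain ⟨m, hm⟩ := N.mkQ_surjective (g p)
    refine Submodule.mem_sup.2 ⟨φ m, ⟨m, rfl⟩, p - φ m, ?_, by abel⟩
    rw [LinearMap.mem_ker, map_sub, ← hm, ← hφ, LinearMap.comp_apply, sub_self]
  refine (eq_top_or_eq_top_of_sup_eq_top k hf hsup).resolve_right fun h => hg0 ?_
  exact LinearMap.mem_ker.1 (h ▸ Submodule.mem_top)

include k in
/-- The kernel of a nonzero homomorphism from `A f` to a simple module is the radical. -/
theorem ker_eq_jacobson (hf : IsPrimitiveIdempotent f) [IsSimpleModule A M]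
    {g : ↥(Submodule.span A {f}) →ₗ[A] M} (hg : g ≠ 0) :
    LinearMap.ker g = Module.jacobson A ↥(Submodule.span A {f}) := by
  have h1 : IsCoatom (LinearMap.ker g) := by
    rw [← isSimpleModule_iff_isCoatom]
    exact IsSimpleModule.congr (g.quotKerEquivOfSurjective (LinearMap.surjective_of_ne_zero hg))
  refine le_antisymm (le_jacobson_of_ne_top (k := k) hf h1.1) (sInf_le h1)

include k in
theorem isSimpleModule_top (hf : IsPrimitiveIdempotent f) :
    IsSimpleModule A (↥(Submodule.span A {f}) ⧸ Module.jacobson A ↥(Submodule.span A {f})) :=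
  isSimpleModule_iff_isCoatom.2 (isCoatom_jacobson_span (k := k) hf)

include k in
theorem nonempty_equiv_top_iff (hf : IsPrimitiveIdempotent f) [IsSimpleModule A M] :
    Nonempty (M ≃ₗ[A] ↥(Submodule.span A {f}) ⧸ Module.jacobson A ↥(Submodule.span A {f})) ↔
      ∃ x : M, f • x ≠ 0 := by
  constructor
  · rintro ⟨φ⟩
    refine ⟨φ.symm (Submodule.mkQ _ (gen f)), ?_⟩
    rw [← map_smul, ← map_smul, LinearEquiv.map_ne_zero_iff, Submodule.mkQ_apply, Ne,
      Submodule.Quotient.mk_eq_zero]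
    convert gen_notMem_jacobson (k := k) hf
    exact smul_gen hf.1 (gen f)
  · rintro ⟨x, hx⟩
    have hg : evalAt f x ≠ 0 := fun h => hx (by
      have := LinearMap.congr_fun h (gen f)
      simpa using this)
    exact ⟨((Submodule.quotEquivOfEq _ _ (ker_eq_jacobson (k := k) hf hg).symm).trans
      ((evalAt f x).quotKerEquivOfSurjective (LinearMap.surjective_of_ne_zero hg))).symm⟩

variable (k) in
-- The space `f • S` is `Hom(A f, S)`, which for the top `S` of `A f` is `End S`, that is, `k` by
-- Schur's lemma. Algebraic closedness enters here.
theorem cornerDim_top [IsAlgClosed k] (hf : IsPrimitiveIdempotent f) :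
    cornerDim k (↥(Submodule.span A {f}) ⧸ Module.jacobson A ↥(Submodule.span A {f})) f = 1 := by
  have hs := isSimpleModule_top (k := k) hf
  set R := Module.jacobson A ↥(Submodule.span A {f})
  have hfg : f • R.mkQ (gen f) = R.mkQ (gen f) := by
    rw [← map_smul]
    congr 1
    exact smul_gen hf.1 (gen f)
  refine (finrank_eq_one_iff_of_nonzero' (⟨R.mkQ (gen f), hfg⟩ : ↥(fixedBy k _ f)) ?_).2 ?_
  · intro h
    have h1 : R.mkQ (gen f) = 0 := congrArg Subtype.val h
    exact gen_notMem_jacobson (k := k) hf ((Submodule.Quotient.mk_eq_zero _).1 h1)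
  · rintro ⟨x, hx⟩
    rw [mem_fixedBy] at hx
    by_cases hx0 : x = 0
    · exact ⟨0, Subtype.ext (by simp [hx0])⟩
    have hg : evalAt f x ≠ 0 := fun h => hx0 (by
      have := LinearMap.congr_fun h (gen f)
      rw [← hx]
      simpa using this)
    let ψ : Module.End A (↥(Submodule.span A {f}) ⧸ R) :=
      R.liftQ (evalAt f x) (ker_eq_jacobson (k := k) hf hg).ge
    obtain ⟨c, hc⟩ := (IsSimpleModule.algebraMap_end_bijective_of_isAlgClosed (A := A)
      (V := ↥(Submodule.span A {f}) ⧸ R) k).2 ψ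
    refine ⟨c, Subtype.ext ?_⟩
    have h2 : ψ (R.mkQ (gen f)) = x := by
      rw [← hx]
      rfl
    change c • R.mkQ (gen f) = x
    rw [← h2, ← hc, Module.algebraMap_end_apply]

end Local

/-! ### Composition multiplicities as dimensions -/

section Multiplicity

variable (k : Type u) [Field k] {A : Type v} [Ring A] [Algebra k A]
  {M : Type*} [AddCommGroup M] [Module A M] [Module k M] [IsScalarTower k A M]

theorem cornerDim_add_submoduleOf {f : A} (hf : IsIdempotentElem f) [FiniteDimensional k M]
    {N N' : Submodule A M} (h : N ≤ N') :
    cornerDim k ↥N' f = cornerDim k ↥N f + cornerDim k (↥N' ⧸ N.submoduleOf N') f := by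
  rw [cornerDim_add k hf (N.submoduleOf N'),
    cornerDim_congr k (Submodule.submoduleOfEquivOfLe h)]

theorem finrank_add_submoduleOf [FiniteDimensional k M] {N N' : Submodule A M} (h : N ≤ N') :
    Module.finrank k (↥N' ⧸ N.submoduleOf N') + Module.finrank k ↥N = Module.finrank k ↥N' := by
  rw [← finrank_quotient_add k (N.submoduleOf N'),
    ((Submodule.submoduleOfEquivOfLe h).restrictScalars k).finrank_eq]

theorem cornerDim_top_submodule (f : A) :
    cornerDim k ↥(⊤ : Submodule A M) f = cornerDim k M f :=
  cornerDim_congr k Submodule.topEquiv f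

theorem eq_add_sum_of_succ {n : ℕ} (F : Fin (n + 1) → ℕ) (g : Fin n → ℕ)
    (h : ∀ i : Fin n, F i.succ = F i.castSucc + g i) : F (Fin.last n) = F 0 + ∑ i, g i := by
  induction n with
  | zero => simp
  | succ n ih =>
    rw [Fin.sum_univ_castSucc, ← Fin.succ_last, h, ← add_assoc]
    congr 1
    exact ih (fun i => F i.castSucc) (fun i => g i.castSucc) fun i => h i.castSucc

variable [FiniteDimensional k A] [IsAlgClosed k]

open Classical in
theorem cornerDim_of_simple {f : A} (hf : IsPrimitiveIdempotent f) [FiniteDimensional k M]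
    [IsSimpleModule A M] : cornerDim k M f =
      if Nonempty (M ≃ₗ[A] ↥(Submodule.span A {f}) ⧸ Module.jacobson A ↥(Submodule.span A {f}))
      then 1 else 0 := by
  split_ifs with h
  · rw [cornerDim_congr k h.some, cornerDim_top k hf]
  · rw [cornerDim_eq_zero_iff k hf.1]
    rw [nonempty_equiv_top_iff (k := k) hf] at h
    push Not at h
    exact h

/-- By additivity along a composition series: a factor contributes one to `dim e_m M` if it is
isomorphic to `S_m`, and zero otherwise. -/
theorem hasMultiplicity_iff {Λ : Type w} {e : Λ → A} (hprim : ∀ l, IsPrimitiveIdempotent (e l))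
    [FiniteDimensional k M] (m : Λ) (n : ℕ) :
    HasMultiplicity A M (SimpleMod e m) n ↔ cornerDim k M (e m) = n := by
  classical
  have key : ∀ s : CompositionSeries (Submodule A M), s.head = ⊥ → s.last = ⊤ →
      Set.ncard {i : Fin s.length | Nonempty ((↥(s i.succ) ⧸
        (s i.castSucc).submoduleOf (s i.succ)) ≃ₗ[A] SimpleMod e m)} = cornerDim k M (e m) := by
    intro s hs ht
    have h1 := eq_add_sum_of_succ (fun i => cornerDim k ↥(s i) (e m))
      (fun i => cornerDim k (↥(s i.succ) ⧸ (s i.castSucc).submoduleOf (s i.succ)) (e m))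
      (fun i => cornerDim_add_submoduleOf k (hprim m).1 (s.step i).le)
    have h2 : cornerDim k ↥(s 0) (e m) = 0 := by
      rw [cornerDim_eq_zero_iff k (hprim m).1]
      rintro ⟨x, hx⟩
      have hx' : x ∈ s.head := hx
      rw [hs, Submodule.mem_bot] at hx'
      exact Subtype.ext (by simp [hx'])
    have h3 : cornerDim k ↥(s (Fin.last _)) (e m) = cornerDim k M (e m) := by
      have : s (Fin.last _) = ⊤ := ht
      rw [this, cornerDim_top_submodule]
    simp only [h2, h3, zero_add] at h1
    rw [h1, Set.ncard_eq_toFinset_card', Finset.card_eq_sum_ones,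
      ← Finset.sum_filter_add_sum_filter_not Finset.univ
      (fun i => Nonempty ((↥(s i.succ) ⧸
        (s i.castSucc).submoduleOf (s i.succ)) ≃ₗ[A] SimpleMod e m))]
    have hsim : ∀ i : Fin s.length,
        IsSimpleModule A (↥(s i.succ) ⧸ (s i.castSucc).submoduleOf (s i.succ)) :=
      fun i => (covBy_iff_quot_is_simple (s.step i).le).1 (s.step i)
    rw [Finset.sum_eq_zero (s := Finset.filter (fun i => ¬ _) _), add_zero]
    · refine Finset.sum_congr (by ext; simp) fun i hi => ?_
      have := hsim i
      rw [cornerDim_of_simple k (hprim m), if_pos (Finset.mem_filter.1 hi).2]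
    · intro i hi
      have := hsim i
      rw [cornerDim_of_simple k (hprim m), if_neg (Finset.mem_filter.1 hi).2]
  constructor
  · rintro ⟨s, hs, ht, rfl⟩
    exact (key s hs ht).symm
  · rintro rfl
    have : IsNoetherian A M := isNoetherian_of_tower k inferInstance
    have : IsArtinian A M := isArtinian_of_tower k inferInstance
    obtain ⟨s, hs, ht⟩ := exists_compositionSeries_of_isNoetherian_isArtinian A M
    exact ⟨s, hs, ht, key s hs ht⟩

end Multiplicity

/-! ### Kernels of the projections onto standard and proper standard modules -/

section Kernels

variable (k : Type u) [Field k] {A : Type v} [Ring A] [Algebra k A] [FiniteDimensional k A]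
  {Λ : Type w} {e : Λ → A}

/-- The nilpotent elements of `f A f`. -/
def nilCorner (f : A) : Set A := {x | f * x = x ∧ x * f = x ∧ IsNilpotent x}

include k in
-- Otherwise `P_l` would map onto the projective module `P_m`. The surjection splits, and since
-- `P_l` is local it is an isomorphism, against basicness.
theorem smul_mem_jacobson_of_ne (hprim : ∀ l, IsPrimitiveIdempotent (e l)) (hbasic : IsBasic e)
    {l m : Λ} (h : m ≠ l) (x : ↥(ProjMod e l)) :
    e m • x ∈ Module.jacobson A ↥(ProjMod e l) := by
  by_contra hx
  have := projective_span_idem (hprim l).1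
  have := projective_span_idem (hprim m).1
  obtain ⟨φ, hφ⟩ := exists_surjective_of_notMem (k := k) (hprim m)
    (isCoatom_jacobson_span (k := k) (hprim l)) hx
  obtain ⟨s, hs⟩ := LinearMap.exists_rightInverse_of_surjective φ (LinearMap.range_eq_top.2 hφ)
  have hs' : ∀ y, φ (s y) = y := fun y => LinearMap.congr_fun hs y
  have hsup : LinearMap.range s ⊔ LinearMap.ker φ = ⊤ := by
    rw [eq_top_iff]
    intro p _
    refine Submodule.mem_sup.2 ⟨s (φ p), ⟨_, rfl⟩, p - s (φ p), ?_, by abel⟩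
    rw [LinearMap.mem_ker, map_sub, hs', sub_self]
  have hinj : Function.Injective s := fun a b hab => by rw [← hs' a, hab, hs']
  rcases eq_top_or_eq_top_of_sup_eq_top k (hprim l) hsup with h1 | h1
  · exact (hbasic m l h).false (LinearEquiv.ofBijective s ⟨hinj, LinearMap.range_eq_top.1 h1⟩)
  · obtain ⟨y, hy⟩ := hφ (gen (e m))
    have : φ y = 0 := LinearMap.mem_ker.1 (h1 ▸ Submodule.mem_top)
    rw [this] at hy
    exact (hprim m).2.1 (congrArg Subtype.val hy).symm

include k in
theorem nilCorner_smul_mem_jacobson (hprim : ∀ l, IsPrimitiveIdempotent (e l)) {l : Λ} {s : A}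
    (hs : s ∈ nilCorner (e l)) (x : ↥(ProjMod e l)) :
    s • x ∈ Module.jacobson A ↥(ProjMod e l) :=
  Module.le_comap_jacobson (evalAt (e l) x) ((mem_jacobson_iff_isNilpotent (k := k)
    (hprim l) (x := ⟨s, (mem_span_idem (hprim l).1).2 hs.2.1⟩) hs.1).2 hs.2.2)

variable [IsAlgClosed k]

/-- The multiplicity of the top of `A f` in its quotient by the submodule generated by the
nilpotent elements of `f A f` and further elements of the radical is one. -/
theorem cornerDim_quotient_genBy (hprim : ∀ l, IsPrimitiveIdempotent (e l)) (l : Λ) {S : Set A}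
    (hS : ∀ s ∈ S, ∀ x : ↥(ProjMod e l), s • x ∈ Module.jacobson A ↥(ProjMod e l)) :
    cornerDim k (↥(ProjMod e l) ⧸
      genBy (S ∪ nilCorner (e l)) (⊤ : Submodule A ↥(ProjMod e l))) (e l) = 1 := by
  set R := Module.jacobson A ↥(ProjMod e l)
  have hidem := (hprim l).1
  have hR : cornerDim k ↥(ProjMod e l) (e l) = cornerDim k ↥R (e l) + 1 := by
    rw [cornerDim_add k hidem R, cornerDim_top k (hprim l)]
  have hle : genBy (S ∪ nilCorner (e l)) ⊤ ≤ R := by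
    refine genBy_le ?_
    rintro s (hs | hs) x -
    · exact hS s hs x
    · exact nilCorner_smul_mem_jacobson k hprim hs x
  have h1 := cornerDim_add k hidem
    (genBy (S ∪ nilCorner (e l)) (⊤ : Submodule A ↥(ProjMod e l)))
  -- On vectors fixed by `e l`, lying in the radical means being nilpotent, so this kernel and the
  -- radical have the same `e l`-part.
  rw [hR, cornerDim_sub_eq k (genBy _ _) R] at h1
  · exact (Nat.add_left_cancel h1).symm
  · refine fun x hx => ⟨fun h => hle h, fun h => ?_⟩
    rw [← smul_gen hidem x]
    refine smul_mem_genBy (Set.mem_union_right _ ?_) Submodule.mem_top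
    exact ⟨congrArg Subtype.val hx, (mem_span_idem hidem).1 x.2,
      (mem_jacobson_iff_isNilpotent (k := k) (hprim l) (congrArg Subtype.val hx)).1 h⟩

variable [LinearOrder Λ]

include k in
-- `S_m` is absent from `P_l / N` exactly when `e m` kills that quotient, so the trace is the least
-- admissible `N`.
theorem standardKer_eq (hprim : ∀ l, IsPrimitiveIdempotent (e l)) (l : Λ) :
    standardKer e l = genBy (e '' Set.Ioi l) ⊤ := by
  have key : ∀ N : Submodule A ↥(ProjMod e l),
      (∀ m : Λ, ¬ m ≤ l → HasMultiplicity A (↥(ProjMod e l) ⧸ N) (SimpleMod e m) 0) ↔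
        genBy (e '' Set.Ioi l) ⊤ ≤ N := by
    intro N
    simp only [hasMultiplicity_iff k hprim, cornerDim_eq_zero_iff k (hprim _).1]
    constructor
    · intro h
      refine genBy_le ?_
      rintro _ ⟨t, ht, rfl⟩ x -
      exact (Submodule.Quotient.mk_eq_zero N).1 (h t (not_le.2 ht) (N.mkQ x))
    · intro h m hm x
      obtain ⟨x, rfl⟩ := N.mkQ_surjective x
      exact (Submodule.Quotient.mk_eq_zero N).2
        (h (smul_mem_genBy (Set.mem_image_of_mem e (not_le.1 hm : m ∈ Set.Ioi l))
          Submodule.mem_top))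
  apply le_antisymm
  · exact sInf_le ((key _).2 le_rfl)
  · exact le_sInf fun N hN => (key N).1 hN

include k in
-- An admissible `N` is proper, so it lies in the radical `R`. The top of `P_l` already accounts for
-- the one copy of `S_l`, hence `e_l (R / N) = 0`, and `N` must absorb the images of the nilpotent
-- elements of `e_l A e_l`.
theorem properStandardKer_eq (hprim : ∀ l, IsPrimitiveIdempotent (e l)) (hbasic : IsBasic e)
    (l : Λ) : properStandardKer e l = genBy (e '' Set.Ioi l ∪ nilCorner (e l)) ⊤ := by
  set R := Module.jacobson A ↥(ProjMod e l)
  have hidem := (hprim l).1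
  have hR : cornerDim k ↥(ProjMod e l) (e l) = cornerDim k ↥R (e l) + 1 := by
    rw [cornerDim_add k hidem R, cornerDim_top k (hprim l)]
  apply le_antisymm
  · refine sInf_le ⟨?_, fun m hm1 hm2 => ?_⟩
    · rw [hasMultiplicity_iff k hprim]
      refine cornerDim_quotient_genBy k hprim l ?_
      rintro _ ⟨t, ht, rfl⟩ x
      exact smul_mem_jacobson_of_ne k hprim hbasic (ne_of_gt ht) x
    · rw [hasMultiplicity_iff k hprim, cornerDim_eq_zero_iff k (hprim m).1]
      intro x
      obtain ⟨x, rfl⟩ := Submodule.mkQ_surjective _ x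
      have hm : m ∈ Set.Ioi l := lt_of_le_of_ne (not_lt.1 hm2) hm1.symm
      exact (Submodule.Quotient.mk_eq_zero _).2
        (smul_mem_genBy (Set.mem_union_left _ (Set.mem_image_of_mem e hm)) Submodule.mem_top)
  · refine le_sInf ?_
    rintro N ⟨hN1, hN2⟩
    rw [hasMultiplicity_iff k hprim] at hN1
    have hNtop : N ≠ ⊤ := by
      rintro rfl
      rw [(cornerDim_eq_zero_iff k hidem).2 fun x => Subsingleton.elim _ _] at hN1
      exact zero_ne_one hN1
    have hNR : N ≤ R := le_jacobson_of_ne_top (k := k) (hprim l) hNtop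
    have h1 := cornerDim_add k hidem N
    rw [hR, hN1, cornerDim_add_submoduleOf k hidem hNR] at h1
    have h2 : cornerDim k (↥R ⧸ N.submoduleOf R) (e l) = 0 := by omega
    rw [cornerDim_eq_zero_iff k hidem] at h2
    refine genBy_le ?_
    rintro _ (⟨t, ht, rfl⟩ | hs) x -
    · have h3 := hN2 t (ne_of_gt ht) (not_lt.2 (le_of_lt ht))
      rw [hasMultiplicity_iff k hprim, cornerDim_eq_zero_iff k (hprim t).1] at h3
      exact (Submodule.Quotient.mk_eq_zero N).1 (h3 (N.mkQ x))
    · have h3 := (Submodule.Quotient.mk_eq_zero _).1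
        (h2 (Submodule.mkQ _ ⟨_, nilCorner_smul_mem_jacobson k hprim hs x⟩))
      have h4 := Submodule.mem_comap.1 h3
      simpa only [Submodule.subtype_apply, Submodule.coe_smul, ← mul_smul, hs.1] using h4

end Kernels

/-! ### Filtrations as chains of single steps -/

section Filtration

variable {A : Type v} [Ring A] {M : Type*} [AddCommGroup M] [Module A M]
  {ι : Type*} (X : ι → Type*) [∀ i, AddCommGroup (X i)] [∀ i, Module A (X i)]

/-- `N ≤ N'` are consecutive terms of a filtration with factors in the family `X`. -/
def FiltStep (N N' : Submodule A M) : Prop :=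
  N ≤ N' ∧ ∃ i, Nonempty ((↥N' ⧸ N.submoduleOf N') ≃ₗ[A] X i)

variable {X}

theorem exists_chain_of_reflTransGen {N N' : Submodule A M}
    (h : Relation.ReflTransGen (FiltStep X) N N') :
    ∃ (n : ℕ) (F : Fin (n + 1) → Submodule A M), F 0 = N ∧ F (Fin.last n) = N' ∧
      ∀ j : Fin n, FiltStep X (F j.castSucc) (F j.succ) := by
  induction h with
  | refl => exact ⟨0, fun _ => N, rfl, rfl, fun j => j.elim0⟩
  | @tail B C _ hBC ih =>
    obtain ⟨n, F, h0, hl, hF⟩ := ih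
    refine ⟨n + 1, Fin.snoc (α := fun _ => Submodule A M) F C, ?_, ?_, fun j => ?_⟩
    · rw [← Fin.castSucc_zero, Fin.snoc_castSucc, h0]
    · rw [Fin.snoc_last]
    · refine Fin.lastCases ?_ (fun j => ?_) j
      · rw [Fin.succ_last, Fin.snoc_last, Fin.snoc_castSucc, hl]
        exact hBC
      · rw [Fin.succ_castSucc, Fin.snoc_castSucc, Fin.snoc_castSucc]
        exact hF j

theorem hasFiltrationBy_of_reflTransGen
    (h : Relation.ReflTransGen (FiltStep X) (⊥ : Submodule A M) ⊤) : HasFiltrationBy A M X := by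
  obtain ⟨n, F, h0, hl, hF⟩ := exists_chain_of_reflTransGen h
  exact ⟨n, F, Fin.monotone_iff_le_succ.2 fun j => (hF j).1, h0, hl, fun j => (hF j).2⟩

theorem HasFiltrationBy.reflTransGen (h : HasFiltrationBy A M X) :
    Relation.ReflTransGen (FiltStep X) (⊥ : Submodule A M) ⊤ := by
  obtain ⟨n, F, hm, h0, hl, hF⟩ := h
  have key : ∀ i, Relation.ReflTransGen (FiltStep X) (⊥ : Submodule A M) (F i) := by
    intro i
    induction i using Fin.induction with
    | zero => rw [h0]
    | succ i ih => exact ih.tail ⟨hm (Fin.castSucc_le_succ i), hF i⟩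
  rw [← hl]
  exact key _

end Filtration

/-! ### Traces along a filtration -/

section Trace

variable {A : Type v} [Ring A] {M : Type*} [AddCommGroup M] [Module A M]

theorem genBy_eq_of_forall_mem {S : Set A} (hS : ∀ s ∈ S, IsIdempotentElem s)
    {N N' : Submodule A M} (hN : N ≤ N') (h : ∀ s ∈ S, ∀ x ∈ N', s • x ∈ N) :
    genBy S N' = genBy S N := by
  refine le_antisymm (genBy_le fun s hs x hx => ?_) (genBy_mono subset_rfl hN)
  rw [← (hS s hs).eq, mul_smul]
  exact smul_mem_genBy hs (h s hs x hx)

variable {f : A} {K : Submodule A ↥(Submodule.span A {f})}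
  {S : Set A} {N N' : Submodule A M}

theorem genBy_eq_of_step_of_forall (hS : ∀ s ∈ S, IsIdempotentElem s) (hN : N ≤ N')
    (φ : (↥N' ⧸ N.submoduleOf N') ≃ₗ[A] ↥(Submodule.span A {f}) ⧸ K)
    (h : ∀ s ∈ S, ∀ p : ↥(Submodule.span A {f}), s • p ∈ K) : genBy S N' = genBy S N := by
  refine genBy_eq_of_forall_mem hS hN fun s hs x hx => ?_
  obtain ⟨p, hp⟩ := K.mkQ_surjective (φ (Submodule.mkQ _ ⟨x, hx⟩))
  have h1 : (N.submoduleOf N').mkQ (s • ⟨x, hx⟩) = 0 := by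
    rw [← φ.map_eq_zero_iff, map_smul, map_smul, ← hp, ← map_smul]
    exact (Submodule.Quotient.mk_eq_zero K).2 (h s hs p)
  exact Submodule.mem_comap.1 ((Submodule.Quotient.mk_eq_zero _).1 h1)

/-- A factor `A f / K` survives the passage to traces if `f ∈ S` and `K` is generated by `S • K`.
Take `x ∈ N'` lifting the generator with `f • x = x`, so that `N' = A x + N`. An element `a • x + g`
of the trace, `g ∈ genBy S N`, lies in `N` only if `a • gen f ∈ K`, and then `a • x ∈ genBy S N`
because `K` is generated by `S • K`. -/
theorem genBy_of_step (hf : IsIdempotentElem f) (hN : N ≤ N')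
    (φ : (↥N' ⧸ N.submoduleOf N') ≃ₗ[A] ↥(Submodule.span A {f}) ⧸ K)
    (hfS : f ∈ S) (hK : K ≤ genBy S K) :
    genBy S N' ⊔ N = N' ∧ genBy S N' ⊓ N = genBy S N := by
  obtain ⟨x₀, hx₀⟩ := Submodule.mkQ_surjective _ (φ.symm (K.mkQ (gen f)))
  set x : ↥N' := f • x₀
  have hmk : ∀ a : A, (N.submoduleOf N').mkQ (a • x) = φ.symm (K.mkQ (a • gen f)) := by
    intro a
    have hg : f • gen f = gen f := smul_gen hf (gen f)
    have h1 : (N.submoduleOf N').mkQ x = φ.symm (K.mkQ (gen f)) := by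
      rw [map_smul, hx₀, ← map_smul, ← map_smul, hg]
    rw [map_smul, h1, map_smul, map_smul]
  have hmem : ∀ a : A, a • (x : M) ∈ N ↔ a • gen f ∈ K := by
    intro a
    have h1 : a • (x : M) ∈ N ↔ a • x ∈ N.submoduleOf N' := Iff.rfl
    rw [h1, ← Submodule.Quotient.mk_eq_zero, ← Submodule.mkQ_apply, hmk,
      LinearEquiv.map_eq_zero_iff, Submodule.mkQ_apply, Submodule.Quotient.mk_eq_zero]
  have hfx : f • (x : M) = x := by
    change f • (f • (x₀ : M)) = f • (x₀ : M)
    rw [← mul_smul, hf.eq]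
  have hdec : ∀ y ∈ N', ∃ a : A, y - a • (x : M) ∈ N := by
    intro y hy
    obtain ⟨p, hp⟩ := K.mkQ_surjective (φ (Submodule.mkQ _ ⟨y, hy⟩))
    refine ⟨p, ?_⟩
    have h1 : (N.submoduleOf N').mkQ (⟨y, hy⟩ - (p : A) • x) = 0 := by
      rw [map_sub, hmk, smul_gen hf, hp, LinearEquiv.symm_apply_apply, sub_self]
    exact Submodule.mem_comap.1 ((Submodule.Quotient.mk_eq_zero _).1 h1)
  have hKx : ∀ p ∈ K, (p : A) • (x : M) ∈ genBy S N := by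
    intro p hp
    have h1 : genBy S K ≤ (genBy S N).comap (evalAt f (x : M)) := by
      refine genBy_le fun s hs q hq => ?_
      rw [Submodule.mem_comap, map_smul]
      refine smul_mem_genBy hs ((hmem q).2 ?_)
      rwa [smul_gen hf]
    exact h1 (hK hp)
  constructor
  · refine le_antisymm (sup_le (genBy_le_self S N') hN) fun y hy => ?_
    obtain ⟨a, ha⟩ := hdec y hy
    refine Submodule.mem_sup.2 ⟨a • (x : M), Submodule.smul_mem _ _ ?_, _, ha, by abel⟩
    rw [← hfx]
    exact smul_mem_genBy hfS x.2
  · refine le_antisymm ?_ (le_inf (genBy_mono subset_rfl hN) (genBy_le_self S N))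
    have h1 : genBy S N' ≤ Submodule.span A {(x : M)} ⊔ genBy S N := by
      refine genBy_le fun s hs y hy => ?_
      obtain ⟨a, ha⟩ := hdec y hy
      refine Submodule.mem_sup.2 ⟨(s * a) • (x : M),
        Submodule.smul_mem _ _ (Submodule.mem_span_singleton_self _),
        s • (y - a • (x : M)), smul_mem_genBy hs ha, ?_⟩
      rw [smul_sub, mul_smul]
      abel
    rintro z ⟨hz, hzN⟩
    obtain ⟨b, hb, g, hg, rfl⟩ := Submodule.mem_sup.1 (h1 hz)
    obtain ⟨a, rfl⟩ := Submodule.mem_span_singleton.1 hb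
    refine Submodule.add_mem _ ?_ hg
    have h2 : a • (x : M) ∈ N := by
      have := N.sub_mem hzN (genBy_le_self S N hg)
      rwa [add_sub_cancel_right] at this
    have h3 := hKx _ ((hmem a).1 h2)
    rwa [Submodule.coe_smul, coe_gen, smul_eq_mul, mul_smul, hfx] at h3

theorem nonempty_genBy_quotient_equiv (hf : IsIdempotentElem f) (hN : N ≤ N')
    (φ : (↥N' ⧸ N.submoduleOf N') ≃ₗ[A] ↥(Submodule.span A {f}) ⧸ K)
    (hfS : f ∈ S) (hK : K ≤ genBy S K) :
    Nonempty ((↥(genBy S N') ⧸ (genBy S N).submoduleOf (genBy S N')) ≃ₗ[A]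
      ↥(Submodule.span A {f}) ⧸ K) := by
  obtain ⟨h1, h2⟩ := genBy_of_step hf hN φ hfS hK
  have ψ := LinearMap.quotientInfEquivSupQuotient (genBy S N') N
  rw [← Submodule.comap_inf, h1, h2] at ψ
  exact ⟨ψ.trans φ⟩

variable {Λ : Type w} {e : Λ → A} {K : ∀ κ, Submodule A ↥(ProjMod e κ)} {T : Set Λ}

theorem projective_of_submodule_of_quotient (L : Submodule A M) [Module.Projective A ↥L]
    [Module.Projective A (M ⧸ L)] : Module.Projective A M := by
  obtain ⟨s, hs⟩ := LinearMap.exists_rightInverse_of_surjective L.mkQ L.range_mkQ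
  have hs' : ∀ y, L.mkQ (s y) = y := fun y => LinearMap.congr_fun hs y
  let r : M →ₗ[A] ↥L := (LinearMap.id - s ∘ₗ L.mkQ).codRestrict L fun x => by
    rw [← Submodule.Quotient.mk_eq_zero, ← Submodule.mkQ_apply]
    rw [LinearMap.sub_apply, map_sub, LinearMap.comp_apply, hs', LinearMap.id_apply, sub_self]
  refine Module.Projective.of_split (M := ↥L × (M ⧸ L)) (r.prod L.mkQ)
    (L.subtype.coprod s) ?_
  ext x
  simp [r]

/-- If the factors indexed by `T` are projective and the others are annihilated by the idempotents
`e t`, `t ∈ T`, then the trace of these idempotents is projective. -/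
theorem projective_genBy (hidem : ∀ l, IsIdempotentElem (e l))
    (hF : HasFiltrationBy A M fun κ => ↥(ProjMod e κ) ⧸ K κ)
    (h1 : ∀ κ ∉ T, ∀ t ∈ T, ∀ p : ↥(ProjMod e κ), e t • p ∈ K κ) (h2 : ∀ κ ∈ T, K κ = ⊥) :
    Module.Projective A ↥(genBy (e '' T) (⊤ : Submodule A M)) := by
  have hS : ∀ s ∈ e '' T, IsIdempotentElem s := by
    rintro _ ⟨t, -, rfl⟩
    exact hidem t
  have h := hF.reflTransGen
  generalize (⊤ : Submodule A M) = L at h ⊢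
  induction h with
  | refl =>
    have : genBy (e '' T) (⊥ : Submodule A M) = ⊥ := le_bot_iff.1 (genBy_le_self _ _)
    rw [this]
    infer_instance
  | @tail N N' _ hstep ih =>
    obtain ⟨hN, κ, ⟨φ⟩⟩ := hstep
    by_cases hκ : κ ∈ T
    · obtain ⟨ψ⟩ := nonempty_genBy_quotient_equiv (hidem κ) hN φ (Set.mem_image_of_mem e hκ)
        (by rw [h2 κ hκ]; exact bot_le)
      have hp := projective_span_idem (hidem κ)
      have := Module.Projective.of_equiv (ψ.trans (Submodule.quotEquivOfEqBot _ (h2 κ hκ))).symm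
      have := Module.Projective.of_equiv
        (Submodule.submoduleOfEquivOfLe (genBy_mono (subset_refl (e '' T)) hN)).symm
      exact projective_of_submodule_of_quotient
        ((genBy (e '' T) N).submoduleOf (genBy (e '' T) N'))
    · rw [genBy_eq_of_step_of_forall hS hN φ]
      · exact ih
      · rintro _ ⟨t, ht, rfl⟩ p
        exact h1 κ hκ t ht p

/-- `m κ` counts the steps labelled `κ` in one chosen filtration. The same numbers serve for the
trace, which keeps the factors labelled by `T` and loses all others. -/
theorem exists_multiplicities (k : Type u) [Field k] [Algebra k A] [Module k M]
    [IsScalarTower k A M] [FiniteDimensional k A] [FiniteDimensional k M] [Fintype Λ]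
    {T : Finset Λ} (hidem : ∀ l, IsIdempotentElem (e l))
    (hF : HasFiltrationBy A M fun κ => ↥(ProjMod e κ) ⧸ K κ)
    (h1 : ∀ κ ∉ T, ∀ t ∈ T, ∀ p : ↥(ProjMod e κ), e t • p ∈ K κ)
    (h2 : ∀ κ ∈ T, K κ ≤ genBy (e '' (T : Set Λ)) (K κ)) :
    ∃ m : Λ → ℕ, ∀ i,
      cornerDim k M (e i) = ∑ κ, m κ * cornerDim k (↥(ProjMod e κ) ⧸ K κ) (e i) ∧
      cornerDim k ↥(genBy (e '' (T : Set Λ)) (⊤ : Submodule A M)) (e i) =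
        ∑ κ ∈ T, m κ * cornerDim k (↥(ProjMod e κ) ⧸ K κ) (e i) := by
  classical
  have hS : ∀ s ∈ e '' (T : Set Λ), IsIdempotentElem s := by
    rintro _ ⟨t, -, rfl⟩
    exact hidem t
  have h := hF.reflTransGen
  suffices H : ∃ m : Λ → ℕ, ∀ i,
      cornerDim k ↥(⊤ : Submodule A M) (e i) =
        ∑ κ, m κ * cornerDim k (↥(ProjMod e κ) ⧸ K κ) (e i) ∧
      cornerDim k ↥(genBy (e '' (T : Set Λ)) (⊤ : Submodule A M)) (e i) =
        ∑ κ ∈ T, m κ * cornerDim k (↥(ProjMod e κ) ⧸ K κ) (e i) by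
    simpa only [cornerDim_top_submodule] using H
  generalize (⊤ : Submodule A M) = L at h ⊢
  induction h with
  | refl =>
    have h0 : genBy (e '' (T : Set Λ)) (⊥ : Submodule A M) = ⊥ := le_bot_iff.1 (genBy_le_self _ _)
    have h3 : ∀ i, cornerDim k ↥(⊥ : Submodule A M) (e i) = 0 := fun i =>
      (cornerDim_eq_zero_iff k (hidem i)).2 fun x => Subsingleton.elim _ _
    exact ⟨fun _ => 0, fun i => ⟨by simp [h3], by rw [h0, h3]; simp⟩⟩
  | @tail N N' _ hstep ih =>
    obtain ⟨hN, κ, ⟨φ⟩⟩ := hstep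
    obtain ⟨m, hm⟩ := ih
    refine ⟨m + Pi.single κ 1, fun i => ⟨?_, ?_⟩⟩
    · rw [cornerDim_add_submoduleOf k (hidem i) hN, (hm i).1, cornerDim_congr k φ]
      simp [add_mul, Finset.sum_add_distrib, Pi.single_apply]
    · have hsum : (∑ κ' ∈ T, (m + Pi.single κ 1 : Λ → ℕ) κ' *
          cornerDim k (↥(ProjMod e κ') ⧸ K κ') (e i)) =
          (∑ κ' ∈ T, m κ' * cornerDim k (↥(ProjMod e κ') ⧸ K κ') (e i)) +
          if κ ∈ T then cornerDim k (↥(ProjMod e κ) ⧸ K κ) (e i) else 0 := by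
        simp [add_mul, Finset.sum_add_distrib, Pi.single_apply]
      rw [hsum]
      by_cases hκ : κ ∈ T
      · obtain ⟨ψ⟩ := nonempty_genBy_quotient_equiv (hidem κ) hN φ (Set.mem_image_of_mem e (Finset.mem_coe.2 hκ))
          (h2 κ hκ)
        rw [cornerDim_add_submoduleOf k (hidem i) (genBy_mono (subset_refl (e '' (T : Set Λ))) hN),
          (hm i).2, cornerDim_congr k ψ, if_pos hκ]
      · rw [genBy_eq_of_step_of_forall hS hN φ, (hm i).2, if_neg hκ, add_zero]
        rintro _ ⟨t, ht, rfl⟩ p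
        exact h1 κ hκ t ht p

end Trace

theorem exists_linearOrder_extending {Λ : Type w} (r : Λ → Λ → Prop) (hr : IsPartialOrder Λ r) :
    ∃ L : LinearOrder Λ, ∀ a b, r a b → L.le a b := by
  classical
  obtain ⟨s, hs, hrs⟩ := extend_partialOrder r
  exact ⟨{ le := s
           le_refl := hs.refl
           le_trans := hs.trans
           le_antisymm := hs.antisymm
           le_total := hs.total
           toDecidableLE := Classical.decRel _ }, hrs⟩

theorem projective_pi {R : Type*} [Ring R] {ι : Type*} [Fintype ι] (M : ι → Type*)
    [∀ i, AddCommGroup (M i)] [∀ i, Module R (M i)] [∀ i, Module.Projective R (M i)] :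
    Module.Projective R (∀ i, M i) := by
  classical
  exact Module.Projective.of_equiv (DFinsupp.linearEquivFunOnFintype (R := R) (M := M))

/-! ### From standard filtrations to directedness and left projectivity -/

section Forward

variable (k : Type u) [Field k] [IsAlgClosed k] {A : Type v} [Ring A] [Algebra k A]
  [FiniteDimensional k A] {Λ : Type w} {e : Λ → A}

include k in
-- In an order with `l` greatest, `Δ_l = P_l` and `e_l` kills all other standard modules, so `A e_l
-- A` is an iterated extension of copies of `P_l`.
theorem projective_genBy_singleton (hprim : ∀ l, IsPrimitiveIdempotent (e l))
    (H : ∀ _ : LinearOrder Λ, HasFiltrationBy A A (StandardMod e)) (l : Λ) :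
    Module.Projective A ↥(genBy (e '' {l}) (⊤ : Submodule A A)) := by
  obtain ⟨L, hL⟩ := exists_linearOrder_extending (fun a b : Λ => a = b ∨ b = l)
    { refl := fun a => Or.inl rfl
      trans := by rintro a b c (rfl | rfl) (rfl | rfl) <;> simp
      antisymm := by rintro a b (h | h) (h' | h') <;> simp_all }
  refine projective_genBy (K := standardKer e) (fun m => (hprim m).1) (H L) ?_ ?_
  · intro κ hκ t ht p
    obtain rfl : t = l := ht
    rw [standardKer_eq k hprim]
    refine smul_mem_genBy (Set.mem_image_of_mem e ?_) Submodule.mem_top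
    exact lt_of_le_of_ne (hL κ t (Or.inr rfl)) hκ
  · intro κ hκ
    obtain rfl : κ = l := hκ
    rw [standardKer_eq k hprim]
    refine le_bot_iff.1 (genBy_le ?_)
    rintro _ ⟨t, ht, rfl⟩
    exact absurd (hL t κ (Or.inr rfl)) (not_le_of_gt ht)

include k in
/-- If `e_l A e_m ≠ 0`, then `A e_l` embeds into `A e_m`. -/
theorem exists_injective_of_mul_ne_zero (hprim : ∀ l, IsPrimitiveIdempotent (e l))
    (H : ∀ _ : LinearOrder Λ, HasFiltrationBy A A (StandardMod e)) {l m : Λ} {x : A}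
    (hx : e l * (x * e m) ≠ 0) :
    ∃ φ : ↥(ProjMod e l) →ₗ[A] ↥(ProjMod e m), Function.Injective φ := by
  set G := genBy (e '' {l}) (⊤ : Submodule A A)
  set D := genBy (e '' {l}) (⊤ : Submodule A ↥(ProjMod e m))
  have hG := projective_genBy_singleton k hprim H l
  have hDG : ∀ y ∈ D, (ProjMod e m).subtype y ∈ G := fun y hy =>
    genBy_mono subset_rfl le_top ((map_genBy _ _ (ProjMod e m).subtype).le
      (Submodule.mem_map_of_mem hy))
  have hGD : ∀ y ∈ G, LinearMap.toSpanSingleton A _ (gen (e m)) y ∈ D := fun y hy =>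
    genBy_mono subset_rfl le_top ((map_genBy _ _ (LinearMap.toSpanSingleton A _ (gen (e m)))).le
      (Submodule.mem_map_of_mem hy))
  -- `D = A e_l A e_m` is a retract of `G = A e_l A` under right multiplication by `e m`.
  have hD : Module.Projective A ↥D := by
    refine Module.Projective.of_split (M := ↥G) ((ProjMod e m).subtype.restrict hDG)
      ((LinearMap.toSpanSingleton A _ (gen (e m))).restrict hGD) ?_
    ext y
    exact (mem_span_idem (hprim m).1).1 y.1.2
  have hy : e l • (x • gen (e m)) ∈ D := smul_mem_genBy (Set.mem_image_of_mem e (Set.mem_singleton l)) Submodule.mem_top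
  have hnt : Nontrivial ↥D := ⟨⟨_, hy⟩, 0, fun h => hx
    (congrArg (fun z : ↥D => ((z : ↥(ProjMod e m)) : A)) h)⟩
  have : IsNoetherian A ↥D := isNoetherian_of_tower k inferInstance
  obtain ⟨N, hN, -⟩ := (eq_top_or_exists_le_coatom (⊥ : Submodule A ↥D)).resolve_left bot_ne_top
  -- `D` is generated by its `e l`-part, which therefore is not contained in a maximal submodule.
  -- Hence `D` maps onto `P_l`, and a section embeds `P_l` into `D`.
  obtain ⟨z, hz⟩ : ∃ z : ↥D, e l • z ∉ N := by
    by_contra! h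
    refine hN.1 (eq_top_iff.2 fun z _ => ?_)
    have h1 : D ≤ N.map D.subtype := by
      refine genBy_le ?_
      rintro _ ⟨t, ht, rfl⟩ y -
      obtain rfl : t = l := ht
      have hy : e t • y ∈ D := smul_mem_genBy (Set.mem_image_of_mem e (Set.mem_singleton t)) Submodule.mem_top
      refine ⟨_, h ⟨_, hy⟩, ?_⟩
      rw [map_smul, Submodule.subtype_apply, ← mul_smul, (hprim t).1.eq]
    obtain ⟨z', hz', hzz⟩ := h1 z.2
    rwa [← Subtype.ext hzz]
  obtain ⟨φ, hφ⟩ := exists_surjective_of_notMem (k := k) (hprim l) hN hz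
  have := projective_span_idem (hprim l).1
  obtain ⟨s, hs⟩ := LinearMap.exists_rightInverse_of_surjective φ (LinearMap.range_eq_top.2 hφ)
  have hs' : ∀ y, φ (s y) = y := fun y => LinearMap.congr_fun hs y
  refine ⟨D.subtype ∘ₗ s, D.subtype_injective.comp fun a b hab => ?_⟩
  rw [← hs' a, hab, hs']

variable [Fintype Λ]

/-- The partial order is embeddability: `l ≤ m` when `P_m` embeds into `P_l`. Embeddings in both
directions are isomorphisms by dimension, so basicness gives antisymmetry. -/
theorem isDirectedCategory_of_standard (he : CompleteOrthogonalIdempotents e)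
    (hprim : ∀ l, IsPrimitiveIdempotent (e l)) (hbasic : IsBasic e)
    (H : ∀ _ : LinearOrder Λ, HasFiltrationBy A A (StandardMod e)) :
    IsDirectedCategory (AssocCat k he) := by
  refine ⟨fun X Y => ∃ φ : ↥(ProjMod e Y.idx) →ₗ[A] ↥(ProjMod e X.idx), Function.Injective φ,
    { refl := fun X => ⟨LinearMap.id, fun _ _ h => h⟩
      trans := fun X Y Z ⟨φ, hφ⟩ ⟨ψ, hψ⟩ => ⟨φ ∘ₗ ψ, hφ.comp hψ⟩
      antisymm := ?_ }, ?_⟩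
  · rintro ⟨l⟩ ⟨m⟩ ⟨φ, hφ⟩ ⟨ψ, hψ⟩
    by_contra hne
    have h1 := LinearMap.finrank_le_finrank_of_injective (f := φ.restrictScalars k) hφ
    have h2 := LinearMap.finrank_le_finrank_of_injective (f := ψ.restrictScalars k) hψ
    have h3 : Function.Surjective (φ.restrictScalars k) :=
      (LinearMap.injective_iff_surjective_of_finrank_eq_finrank (le_antisymm h1 h2)).1 hφ
    exact (hbasic m l fun h => hne (by rw [h])).false (LinearEquiv.ofBijective φ ⟨hφ, h3⟩)
  · rintro ⟨l⟩ ⟨m⟩ ⟨x, hx⟩ hne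
    obtain ⟨a, rfl⟩ := (mem_peirce k).1 hx
    exact exists_injective_of_mul_ne_zero k hprim H fun h => hne (Subtype.ext h)

variable {k} in
omit [IsAlgClosed k] [FiniteDimensional k A] in
theorem exists_partialOrder_of_isDirected {he : CompleteOrthogonalIdempotents e}
    (hd : IsDirectedCategory (AssocCat k he)) :
    ∃ r : Λ → Λ → Prop, IsPartialOrder Λ r ∧ ∀ l m a, e m * (a * e l) ≠ 0 → r l m := by
  obtain ⟨r, hr, h⟩ := hd
  refine ⟨fun l m => r ⟨l⟩ ⟨m⟩, { refl := fun a => hr.refl _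
                                  trans := fun a b c => hr.trans _ _ _
                                  antisymm := fun a b h1 h2 =>
                                    congrArg AssocCat.idx (hr.antisymm _ _ h1 h2) }, ?_⟩
  intro l m a hne
  exact h ⟨l⟩ ⟨m⟩ ⟨_, (mem_peirce k).2 ⟨a, rfl⟩⟩ fun h0 => hne (congrArg Subtype.val h0)

omit [Fintype Λ] in
include k in
-- The order puts `μ` first and reverses `r` on the rest. For `t > κ ≠ μ` one has `e_t A e_κ = 0`,
-- since otherwise `r κ t` would give `t ≤ κ`. Thus `Δ_κ = P_κ`, while `Δ_μ` is killed by every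
-- `e_t` with `t ≠ μ`.
theorem projective_genBy_compl (hprim : ∀ l, IsPrimitiveIdempotent (e l))
    {r : Λ → Λ → Prop} (hr : IsPartialOrder Λ r) (hre : ∀ l m a, e m * (a * e l) ≠ 0 → r l m)
    (H : ∀ _ : LinearOrder Λ, HasFiltrationBy A A (StandardMod e)) (μ : Λ) :
    Module.Projective A ↥(genBy (e '' {μ}ᶜ) (⊤ : Submodule A A)) := by
  obtain ⟨L, hL⟩ := exists_linearOrder_extending (fun a b : Λ => a = μ ∨ (b ≠ μ ∧ r b a))
    { refl := fun a => by
        by_cases h : a = μ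
        · exact Or.inl h
        · exact Or.inr ⟨h, hr.refl a⟩
      trans := by
        rintro a b c (h | ⟨h, h'⟩) (h1 | ⟨h1, h1'⟩)
        · exact Or.inl h
        · exact Or.inl h
        · exact absurd h1 h
        · exact Or.inr ⟨h1, hr.trans _ _ _ h1' h'⟩
      antisymm := by
        rintro a b (h | ⟨h, h'⟩) (h1 | ⟨h1, h1'⟩)
        · rw [h, h1]
        · exact absurd h h1
        · exact absurd h1 h
        · exact hr.antisymm _ _ h1' h' }
  refine projective_genBy (K := standardKer e) (fun m => (hprim m).1) (H L) ?_ ?_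
  · intro κ hκ t ht p
    obtain rfl : κ = μ := not_not.1 hκ
    rw [standardKer_eq k hprim]
    refine smul_mem_genBy (Set.mem_image_of_mem e ?_) Submodule.mem_top
    exact lt_of_le_of_ne (hL κ t (Or.inl rfl)) (Ne.symm ht)
  · intro κ hκ
    rw [standardKer_eq k hprim]
    refine le_bot_iff.1 (genBy_le ?_)
    rintro _ ⟨t, ht, rfl⟩ p -
    by_contra h0
    refine absurd (hL t κ (Or.inr ⟨hκ, hre κ t p fun h => h0 ?_⟩)) (not_le_of_gt ht)
    rw [(mem_span_idem (hprim κ).1).1 p.2] at h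
    exact (Submodule.mem_bot A).2 (Subtype.ext h)

omit [IsAlgClosed k] [FiniteDimensional k A] in
theorem mul_mem_genBy_of_mem_offDiag (he : CompleteOrthogonalIdempotents e) {x : A}
    (hx : x ∈ offDiag k e) (μ : Λ) : x * e μ ∈ genBy (e '' {μ}ᶜ) (⊤ : Submodule A A) := by
  suffices h : offDiag k e ≤ ((genBy (e '' {μ}ᶜ) (⊤ : Submodule A A)).restrictScalars k).comap
    (LinearMap.mulRight k (e μ)) from h hx
  refine offDiag_le fun l m hlm y hy => ?_
  change y * e μ ∈ genBy (e '' {μ}ᶜ) (⊤ : Submodule A A)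
  by_cases h : l = μ
  · subst h
    rw [← e_mul_of_mem k he hy, mul_assoc]
    exact smul_mem_genBy (x := y * e l) (Set.mem_image_of_mem e (Ne.symm hlm)) Submodule.mem_top
  · rw [← mul_e_of_mem k he hy, mul_assoc, he.ortho h, mul_zero]
    exact Submodule.zero_mem _

/-- `J` is a retract of the product of the traces in `projective_genBy_compl`, by `x ↦ (x e_μ)_μ`
and `(y_μ) ↦ ∑ y_μ e_μ`. -/
theorem projective_leftJ (hprim : ∀ l, IsPrimitiveIdempotent (e l))
    {he : CompleteOrthogonalIdempotents e} (hd : IsDirectedCategory (AssocCat k he))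
    (H : ∀ _ : LinearOrder Λ, HasFiltrationBy A A (StandardMod e)) :
    Module.Projective A ↥(leftJ hd) := by
  obtain ⟨r, hr, hre⟩ := exists_partialOrder_of_isDirected hd
  have hproj := fun μ => projective_genBy_compl k hprim hr hre H μ
  have := projective_pi (R := A) fun μ : Λ => ↥(genBy (e '' {μ}ᶜ) (⊤ : Submodule A A))
  have hmem : ∀ μ, ∀ y ∈ genBy (e '' {μ}ᶜ) (⊤ : Submodule A A),
      LinearMap.toSpanSingleton A A (e μ) y ∈ leftJ hd := by
    intro μ y hy
    have h : genBy (e '' {μ}ᶜ) (⊤ : Submodule A A) ≤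
        (leftJ hd).comap (LinearMap.toSpanSingleton A A (e μ)) := by
      refine genBy_le ?_
      rintro _ ⟨t, ht, rfl⟩ x -
      refine peirce_le_offDiag (Ne.symm ht) ((mem_peirce k).2 ⟨x, ?_⟩)
      simp [mul_assoc]
    exact h hy
  refine Module.Projective.of_split
    (M := ∀ μ : Λ, ↥(genBy (e '' {μ}ᶜ) (⊤ : Submodule A A)))
    (LinearMap.pi fun μ => (LinearMap.toSpanSingleton A A (e μ)).restrict fun x hx =>
      mul_mem_genBy_of_mem_offDiag k he hx μ)
    (∑ μ, ((LinearMap.toSpanSingleton A A (e μ)).restrict (hmem μ)) ∘ₗ LinearMap.proj μ) ?_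
  refine LinearMap.ext fun x => Subtype.ext ?_
  simp only [LinearMap.comp_apply, LinearMap.sum_apply, LinearMap.id_apply, Submodule.coe_sum]
  have h : ∀ μ, (x : A) * e μ * e μ = x * e μ := fun μ => by rw [mul_assoc, (he.idem μ).eq]
  change ∑ μ, (x : A) * e μ * e μ = x
  simp only [h]
  rw [← Finset.mul_sum, he.complete, mul_one]

end Forward

/-! ### Nakayama's lemma for subspaces of `A` -/

section Nakayama

variable {k : Type u} [Field k] {A : Type v} [Ring A] [Algebra k A]

/-- Substituting the inclusion into itself gives `J ≤ R ⊔ J * N ^ i` for every `i`. -/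
theorem le_of_le_sup_mul {J R N : Submodule k A} (hJ : J ≤ R ⊔ J * N) (hR : R * N ≤ R)
    (hN : IsNilpotent N) : J ≤ R := by
  obtain ⟨n, hn⟩ := hN
  have h : ∀ i : ℕ, J ≤ R ⊔ J * N ^ i := by
    intro i
    induction i with
    | zero => simp
    | succ i ih =>
      have h1 : J * N ≤ (R ⊔ J * N ^ i) * N := Submodule.smul_mono_left ih
      refine hJ.trans (sup_le le_sup_left (h1.trans ?_))
      rw [Submodule.sup_mul, mul_assoc, ← pow_succ]
      exact sup_le_sup_right hR _
  have h1 := h n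
  rwa [hn, Submodule.zero_eq_bot, Submodule.mul_bot, sup_bot_eq] at h1

variable (k A) in
theorem isNilpotent_jacobson [FiniteDimensional k A] :
    IsNilpotent ((Ring.jacobson A).restrictScalars k) := by
  have : IsArtinianRing A := isArtinian_of_tower k inferInstance
  obtain ⟨n, hn⟩ := IsArtinianRing.isNilpotent_jacobson_bot (R := A)
  rw [Ideal.jacobson_bot] at hn
  have h : ∀ i : ℕ, ((Ring.jacobson A).restrictScalars k) ^ (i + 1) ≤
      ((Ring.jacobson A) ^ (i + 1)).restrictScalars k := by
    intro i
    induction i with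
    | zero => rw [zero_add, pow_one, Submodule.pow_one]
    | succ i ih =>
      rw [pow_succ, Submodule.mul_le]
      intro x hx y hy
      rw [Submodule.pow_succ]
      exact Ideal.mul_mem_mul (ih hx) hy
  refine ⟨n + 1, le_bot_iff.1 ((h n).trans ?_)⟩
  intro x hx
  rw [Submodule.pow_succ, hn] at hx
  simpa using hx

end Nakayama

/-! ### Right ideals as modules over the opposite ring -/

section RightModules

variable {A : Type v} [Ring A]

variable (A) in
/-- The ring as a right module over itself, identified with its opposite as a left module. -/
def opEquiv : A ≃ₗ[Aᵐᵒᵖ] Aᵐᵒᵖ where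
  toFun := MulOpposite.op
  invFun := MulOpposite.unop
  map_add' _ _ := rfl
  map_smul' _ _ := rfl
  left_inv _ := rfl
  right_inv _ := rfl

/-- The right ideal `f A` of an idempotent `f`. -/
def rightIdeal (f : A) : Submodule Aᵐᵒᵖ A where
  carrier := {x | f * x = x}
  add_mem' {x y} hx hy := by
    simp only [Set.mem_ofPred_eq] at *
    rw [mul_add, hx, hy]
  zero_mem' := mul_zero f
  smul_mem' a x hx := by
    simp only [Set.mem_ofPred_eq] at *
    change f * (x * a.unop) = x * a.unop
    rw [← mul_assoc, hx]

theorem mem_rightIdeal {f x : A} : x ∈ rightIdeal f ↔ f * x = x := Iff.rfl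

/-- Left multiplication, as a homomorphism of right modules. -/
def leftMul (g : A) : A →ₗ[Aᵐᵒᵖ] A where
  toFun x := g * x
  map_add' := mul_add g
  map_smul' a x := (mul_assoc g x a.unop).symm

@[simp]
theorem leftMul_apply (g x : A) : leftMul g x = g * x := rfl

theorem projective_rightIdeal {f : A} (hf : IsIdempotentElem f) :
    Module.Projective Aᵐᵒᵖ ↥(rightIdeal f) := by
  have : Module.Projective Aᵐᵒᵖ A := Module.Projective.of_equiv (opEquiv A).symm
  refine Module.Projective.of_split (M := A) (rightIdeal f).subtype
    ((leftMul f).codRestrict (rightIdeal f) fun x => ?_) ?_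
  · rw [mem_rightIdeal, leftMul_apply, ← mul_assoc, hf.eq]
  · exact LinearMap.ext fun x => Subtype.ext x.2

end RightModules

/-! ### From proper standard filtrations to right projectivity -/

section Right

variable (k : Type u) [Field k] {A : Type v} [Ring A] [Algebra k A]
  [FiniteDimensional k A] {Λ : Type w} [Fintype Λ] {e : Λ → A}

/-- A right ideal generated by elements `g i = g i * f i`, where the dimensions of the right ideals
`f i A` add up to its dimension, is projective. -/
theorem projective_of_generators {ι : Type*} [Fintype ι] {N : Submodule Aᵐᵒᵖ A} {f g : ι → A}
    (hf : ∀ i, IsIdempotentElem (f i)) (hgf : ∀ i, g i * f i = g i) (hg : ∀ i, g i ∈ N)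
    (hgen : ∀ R : Submodule Aᵐᵒᵖ A, (∀ i, g i ∈ R) → N ≤ R)
    (hdim : ∑ i, cornerDim k A (f i) = Module.finrank k ↥N) : Module.Projective Aᵐᵒᵖ ↥N := by
  classical
  have hproj := fun i => projective_rightIdeal (hf i)
  have hpi := projective_pi (R := Aᵐᵒᵖ) fun i => ↥(rightIdeal (f i))
  let Φ : (∀ i, ↥(rightIdeal (f i))) →ₗ[Aᵐᵒᵖ] A :=
    ∑ i, leftMul (g i) ∘ₗ (rightIdeal (f i)).subtype ∘ₗ LinearMap.proj i
  have hΦ : ∀ q, Φ q = ∑ i, g i * (q i : A) := fun q => by simp [Φ]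
  have hmem : ∀ q, Φ q ∈ N := fun q => by
    rw [hΦ]
    exact Submodule.sum_mem _ fun i _ => N.smul_mem (MulOpposite.op (q i : A)) (hg i)
  have hrange : N ≤ LinearMap.range Φ := by
    refine hgen _ fun i => ⟨Pi.single i ⟨f i, (hf i).eq⟩, ?_⟩
    rw [hΦ, Finset.sum_eq_single i]
    · rw [Pi.single_eq_same, hgf]
    · intro j _ hj
      rw [Pi.single_eq_of_ne hj, Submodule.coe_zero, mul_zero]
    · simp
  let Ψ := Φ.codRestrict N hmem
  have hsurj : Function.Surjective Ψ := by
    rintro ⟨x, hx⟩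
    obtain ⟨q, hq⟩ := hrange hx
    exact ⟨q, Subtype.ext hq⟩
  -- `rightIdeal (f i)` and `fixedBy k A (f i)` have the same elements, so `cornerDim k A (f i)` is
  -- the dimension of `f i A`.
  have hdim' : Module.finrank k (∀ i, ↥(rightIdeal (f i))) = Module.finrank k ↥N := by
    rw [Module.finrank_pi_fintype, ← hdim]
    rfl
  have hinj := (LinearMap.injective_iff_surjective_of_finrank_eq_finrank hdim'
    (f := Ψ.restrictScalars k)).2 hsurj
  exact Module.Projective.of_equiv (LinearEquiv.ofBijective Ψ ⟨hinj, hsurj⟩)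

omit [FiniteDimensional k A] in
theorem sum_cornerDim (he : CompleteOrthogonalIdempotents e) (M : Type*) [AddCommGroup M]
    [Module A M] [Module k M] [IsScalarTower k A M] [FiniteDimensional k M] :
    ∑ l, cornerDim k M (e l) = Module.finrank k M := by
  let φ : M ≃ₗ[k] ∀ l, ↥(fixedBy k M (e l)) :=
    LinearEquiv.ofLinearMap
      (LinearMap.pi fun l => (Algebra.lsmul k k M (e l)).codRestrict _ fun x => by
        rw [mem_fixedBy, Algebra.lsmul_coe, ← mul_smul, (he.idem l).eq])
      (∑ l, (fixedBy k M (e l)).subtype ∘ₗ LinearMap.proj l)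
      (by
        refine LinearMap.ext fun x => funext fun l => Subtype.ext ?_
        simp only [LinearMap.comp_apply, LinearMap.sum_apply, LinearMap.pi_apply,
          LinearMap.id_apply]
        change e l • ∑ m, (x m : M) = x l
        rw [Finset.smul_sum, Finset.sum_eq_single l]
        · exact (x l).2
        · intro m _ hm
          have h1 : e m • (x m : M) = x m := (x m).2
          rw [← h1, ← mul_smul, he.ortho hm.symm, zero_smul]
        · simp)
      (by
        refine LinearMap.ext fun x => ?_
        simp only [LinearMap.comp_apply, LinearMap.sum_apply, LinearMap.id_apply]
        change ∑ l, e l • x = x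
        rw [← Finset.sum_smul, he.complete, one_smul])
  rw [φ.finrank_eq, Module.finrank_pi_fintype]
  rfl

variable {k} in
omit [FiniteDimensional k A] in
theorem e_mul_mul_e_of_mem_offDiag (he : CompleteOrthogonalIdempotents e) {x : A}
    (hx : x ∈ offDiag k e) (ν : Λ) : e ν * x * e ν = 0 := by
  suffices h : offDiag k e ≤ LinearMap.ker (LinearMap.mulRight k (e ν) ∘ₗ LinearMap.mulLeft k (e ν))
    from h hx
  refine offDiag_le fun l m hlm y hy => ?_
  change e ν * y * e ν = 0
  by_cases h : l = ν
  · subst h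
    rw [← e_mul_of_mem k he hy, ← mul_assoc, he.ortho hlm, zero_mul, zero_mul]
  · rw [← mul_e_of_mem k he hy, mul_assoc, mul_assoc, he.ortho h, mul_zero, mul_zero]

variable {k} in
omit [FiniteDimensional k A] in
-- Identifies the `e ν`-part of the trace, which a filtration counts, with `e_ν J`. In `e_ν A e_t
-- A`, `t ≠ ν`, the factor `e_ν A e_t` lies in the ideal `J`; conversely `x ∈ e_ν J` has `x e_ν =
-- 0`, so `x` is the sum of the `x e_μ` with `μ ≠ ν`.
theorem mem_genBy_compl_iff_mem_leftJ {he : CompleteOrthogonalIdempotents e}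
    (hd : IsDirectedCategory (AssocCat k he)) {ν : Λ} {x : A} (hx : e ν * x = x) :
    x ∈ genBy (e '' {ν}ᶜ) (⊤ : Submodule A A) ↔ x ∈ leftJ hd := by
  constructor
  · intro h
    have key : ∀ a : A, e ν * (a * x) ∈ offDiag k e := by
      clear hx
      induction h using Submodule.span_induction with
      | mem y hy =>
        intro a
        obtain ⟨_, ⟨t, ht, rfl⟩, z, -, rfl⟩ := hy
        rw [smul_eq_mul, show e ν * (a * (e t * z)) = e ν * (a * e t) * z by simp only [mul_assoc]]
        exact mul_mem_offDiag_right hd z (peirce_le_offDiag ht ((mem_peirce k).2 ⟨a, rfl⟩))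
      | zero => simp
      | add y z _ _ hy hz =>
        intro a
        rw [mul_add, mul_add]
        exact Submodule.add_mem _ (hy a) (hz a)
      | smul b y _ hy =>
        intro a
        rw [smul_eq_mul, ← mul_assoc a b y]
        exact hy (a * b)
    have := key 1
    rwa [one_mul, hx] at this
  · intro h
    have h1 : x = ∑ μ, x * e μ := by rw [← Finset.mul_sum, he.complete, mul_one]
    rw [h1]
    refine Submodule.sum_mem _ fun μ _ => ?_
    by_cases hμ : μ = ν
    · subst hμ
      have h2 := e_mul_mul_e_of_mem_offDiag he h μ
      rw [hx] at h2
      rw [h2]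
      exact Submodule.zero_mem _
    · refine Submodule.smul_mem _ x ?_
      rw [← mul_one (e μ)]
      exact smul_mem_genBy (x := (1 : A)) (Set.mem_image_of_mem e hμ) Submodule.mem_top

variable [IsAlgClosed k] [DecidableEq Λ]

/-- Generators of the right module `e_ν J`, as few as the dimension count for a proper standard
filtration allows. -/
theorem exists_generators (hprim : ∀ l, IsPrimitiveIdempotent (e l)) (hbasic : IsBasic e)
    {he : CompleteOrthogonalIdempotents e} (hd : IsDirectedCategory (AssocCat k he))
    (H : ∀ _ : LinearOrder Λ, HasFiltrationBy A A (ProperStandardMod e)) (ν : Λ) :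
    ∃ c : {κ // κ ≠ ν} → ℕ,
      cornerDim k ↥(leftJ hd) (e ν) = ∑ κ, c κ * cornerDim k A (e κ) ∧
      ∀ κ, ∃ g : Fin (c κ) → A, (∀ i, g i ∈ peirce k e κ ν) ∧ peirce k e κ ν ≤
        Submodule.span k (Set.range g) ⊔ offDiag k e * (Ring.jacobson A).restrictScalars k := by
  obtain ⟨r, hr, hre⟩ := exists_partialOrder_of_isDirected hd
  -- Here `ν` is least and the other indices extend `r` itself, not its reverse as for the left
  -- module.
  obtain ⟨L, hL⟩ := exists_linearOrder_extending (fun a b : Λ => a = ν ∨ (b ≠ ν ∧ r a b))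
    { refl := fun a => by
        by_cases h : a = ν
        · exact Or.inl h
        · exact Or.inr ⟨h, hr.refl a⟩
      trans := by
        rintro a b c (h | ⟨h, h'⟩) (h1 | ⟨h1, h1'⟩)
        · exact Or.inl h
        · exact Or.inl h
        · exact absurd h1 h
        · exact Or.inr ⟨h1, hr.trans _ _ _ h' h1'⟩
      antisymm := by
        rintro a b (h | ⟨h, h'⟩) (h1 | ⟨h1, h1'⟩)
        · rw [h, h1]
        · exact absurd h h1
        · exact absurd h1 h
        · exact hr.antisymm _ _ h' h1' }
  have hidem : ∀ l, IsIdempotentElem (e l) := fun l => (hprim l).1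
  have hmin : ∀ a, ν ≤ a := fun a => hL ν a (Or.inl rfl)
  have hK := properStandardKer_eq k hprim hbasic
  have hup : ∀ {κ t : Λ}, κ < t → ∀ p : ↥(ProjMod e κ), e t • p ∈ properStandardKer e κ := by
    intro κ t ht p
    rw [hK]
    exact smul_mem_genBy (Set.mem_union_left _ (Set.mem_image_of_mem e ht)) Submodule.mem_top
  obtain ⟨m, hm⟩ := exists_multiplicities (K := properStandardKer e) (T := Finset.univ.erase ν)
    k hidem (H L) (by
      intro κ hκ t ht p
      obtain rfl : κ = ν := by simpa using hκ
      exact hup (lt_of_le_of_ne (hmin t) (Finset.ne_of_mem_erase ht).symm) p) (by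
      intro κ hκ
      have hκν : κ ≠ ν := Finset.ne_of_mem_erase hκ
      -- The generators of the kernel carry on their left an idempotent `e t`, `t > κ`, or `e κ`;
      -- none of these is `e ν`.
      conv_lhs => rw [hK]
      refine genBy_le ?_
      rintro s (⟨t, ht, rfl⟩ | hs) p -
      · have h1 : t ∈ ((Finset.univ.erase ν : Finset Λ) : Set Λ) := by
          simpa using ((hmin κ).trans_lt ht).ne'
        rw [← (hidem t).eq, mul_smul]
        exact smul_mem_genBy (Set.mem_image_of_mem e h1) (hup ht p)
      · rw [← hs.1, mul_smul]
        refine smul_mem_genBy (Set.mem_image_of_mem e (Finset.mem_coe.2 hκ)) ?_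
        rw [hK]
        exact smul_mem_genBy (Set.mem_union_right _ hs) Submodule.mem_top)
  have hT : ((Finset.univ.erase ν : Finset Λ) : Set Λ) = {ν}ᶜ := by ext; simp
  -- `e κ` kills `Δ̄_κ'` for `κ' < κ` by construction, and for `κ' > κ` because the order forces
  -- `e_κ A e_κ' = 0`. Only `Δ̄_κ` contributes to `dim e_κ A`, with `e_κ Δ̄_κ` of dimension one.
  have hmκ : ∀ κ, κ ≠ ν → m κ = cornerDim k A (e κ) := by
    intro κ hκ
    rw [(hm κ).1, Finset.sum_eq_single κ]
    · rw [hK, cornerDim_quotient_genBy k hprim, mul_one]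
      rintro _ ⟨t, ht, rfl⟩ x
      exact smul_mem_jacobson_of_ne k hprim hbasic (ne_of_gt ht) x
    · intro κ' _ hne
      rw [(cornerDim_eq_zero_iff k (hidem κ)).2, mul_zero]
      intro x
      obtain ⟨p, rfl⟩ := Submodule.mkQ_surjective _ x
      refine (Submodule.Quotient.mk_eq_zero _).2 ?_
      rcases lt_or_gt_of_ne hne with h | h
      · exact hup h p
      · have h0 : e κ • p = 0 := by
          by_contra h0
          refine absurd (hL κ' κ (Or.inr ⟨hκ, hre κ' κ p fun h' => h0 ?_⟩)) (not_le_of_gt h)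
          rw [(mem_span_idem (hidem κ')).1 p.2] at h'
          exact Subtype.ext h'
        exact (congrArg (· ∈ properStandardKer e κ') h0).mpr (Submodule.zero_mem _)
    · simp
  -- The number of generators is `dim e_ν Δ̄_κ`; the generators are lifts of a basis of that space.
  refine ⟨fun κ => cornerDim k (↥(ProjMod e κ) ⧸ properStandardKer e κ) (e ν), ?_, ?_⟩
  · rw [← cornerDim_sub_eq k _ _ fun x hx => mem_genBy_compl_iff_mem_leftJ hd hx, ← hT,
      (hm ν).2, Finset.sum_subtype (p := fun κ => κ ≠ ν) _ (by simp)]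
    exact Finset.sum_congr rfl fun κ _ => by rw [hmκ κ κ.2, mul_comm]
  · rintro ⟨κ, hκ⟩
    set K := properStandardKer e κ with hKdef
    let b := Module.finBasis k ↥(fixedBy k (↥(ProjMod e κ) ⧸ K) (e ν))
    choose p hp using fun i => K.mkQ_surjective (b i : ↥(ProjMod e κ) ⧸ K)
    have hpi : ∀ i, K.mkQ (e ν • p i) = b i := fun i => by
      rw [map_smul, hp]
      exact (b i).2
    have hmem : ∀ i, e ν * (p i : A) ∈ peirce k e κ ν := fun i =>
      (mem_peirce k).2 ⟨p i, by rw [(mem_span_idem (hidem κ)).1 (p i).2]⟩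
    refine ⟨fun i => e ν * (p i : A), hmem, fun y hy => ?_⟩
    have hyν := e_mul_of_mem k he hy
    have hyP : y ∈ ProjMod e κ := (mem_span_idem (hidem κ)).2 (mul_e_of_mem k he hy)
    have hyfix : K.mkQ ⟨y, hyP⟩ ∈ fixedBy k (↥(ProjMod e κ) ⧸ K) (e ν) := by
      rw [mem_fixedBy, ← map_smul]
      congr 1
      exact Subtype.ext hyν
    have hrepr := b.sum_repr ⟨_, hyfix⟩
    set q := b.repr ⟨_, hyfix⟩
    have hz : (⟨y, hyP⟩ - ∑ i, q i • (e ν • p i) : ↥(ProjMod e κ)) ∈ K := by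
      rw [← Submodule.Quotient.mk_eq_zero, ← Submodule.mkQ_apply, map_sub, map_sum, sub_eq_zero]
      have h1 := congrArg Subtype.val hrepr
      refine h1.symm.trans ?_
      rw [Submodule.coe_sum]
      refine Finset.sum_congr rfl fun i _ => ?_
      rw [Submodule.coe_smul, ← hpi]
      exact ((K.mkQ.restrictScalars k).map_smul (q i) (e ν • p i)).symm
    -- The error of the lift lies in `J * rad A`: a generator of `K` contributes `(e_ν a e_t) (e_t
    -- x)` with first factor in `J` and second in the radical (`t = κ` for a nilpotent generator).
    -- The left factor `a` makes the span induction work.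
    have key : ∀ z ∈ K, ∀ a : A,
        e ν * (a * (z : A)) ∈ offDiag k e * (Ring.jacobson A).restrictScalars k := by
      intro z hz
      rw [hKdef, hK] at hz
      have hjac : ∀ w : ↥(ProjMod e κ), w ∈ Module.jacobson A ↥(ProjMod e κ) →
          (w : A) ∈ Ring.jacobson A := fun w hw =>
        Module.le_comap_jacobson (ProjMod e κ).subtype hw
      induction hz using Submodule.span_induction with
      | mem z hz =>
        intro a
        obtain ⟨s, ⟨t, ht, rfl⟩ | hs, x, -, rfl⟩ := hz
        · have h1 : t ≠ ν := ((hmin κ).trans_lt ht).ne'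
          rw [Submodule.coe_smul, smul_eq_mul, ← (hidem t).eq, mul_assoc (e t), ← mul_assoc a,
            ← mul_assoc (e ν)]
          refine Submodule.mul_mem_mul (peirce_le_offDiag h1 ((mem_peirce k).2 ⟨a, rfl⟩)) ?_
          exact hjac (e t • x) (smul_mem_jacobson_of_ne k hprim hbasic (ne_of_gt ht) x)
        · rw [Submodule.coe_smul, smul_eq_mul, ← hs.1, mul_assoc (e κ), ← mul_assoc a,
            ← mul_assoc (e ν)]
          refine Submodule.mul_mem_mul (peirce_le_offDiag hκ ((mem_peirce k).2 ⟨a, rfl⟩)) ?_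
          exact hjac (s • x) (nilCorner_smul_mem_jacobson k hprim hs x)
      | zero => simp
      | add y z _ _ hy hz =>
        intro a
        rw [Submodule.coe_add, mul_add, mul_add]
        exact Submodule.add_mem _ (hy a) (hz a)
      | smul b y _ hy =>
        intro a
        rw [Submodule.coe_smul, smul_eq_mul, ← mul_assoc a b]
        exact hy (a * b)
    refine Submodule.mem_sup.2 ⟨∑ i, q i • (e ν * (p i : A)), ?_, _, key _ hz 1, ?_⟩
    · exact Submodule.sum_mem _ fun i _ => Submodule.smul_mem _ _ (Submodule.subset_span ⟨i, rfl⟩)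
    · have h2 : (((⟨y, hyP⟩ - ∑ i, q i • (e ν • p i) : ↥(ProjMod e κ)) : ↥(ProjMod e κ)) : A) =
          y - ∑ i, q i • (e ν * (p i : A)) := by
        rw [Submodule.coe_sub, Submodule.coe_sum]
        rfl
      rw [h2, one_mul, mul_sub, hyν, Finset.mul_sum]
      have h3 : ∀ i, e ν * (q i • (e ν * (p i : A))) = q i • (e ν * (p i : A)) := fun i => by
        rw [mul_smul_comm, ← mul_assoc, (hidem ν).eq]
      simp only [h3]
      abel

/-- For all `ν` together, the elements of `exists_generators` span `J` modulo `J * rad A`, hence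
generate it. Their count gives `dim J`, since the left and right modules `J` share one underlying
space. -/
theorem projective_rightJ (hprim : ∀ l, IsPrimitiveIdempotent (e l)) (hbasic : IsBasic e)
    {he : CompleteOrthogonalIdempotents e} (hd : IsDirectedCategory (AssocCat k he))
    (H : ∀ _ : LinearOrder Λ, HasFiltrationBy A A (ProperStandardMod e)) :
    Module.Projective Aᵐᵒᵖ ↥(rightJ hd) := by
  choose c hc g hg hspan using exists_generators k hprim hbasic hd H
  refine projective_of_generators k (ι := Σ ν : Λ, Σ κ : {κ // κ ≠ ν}, Fin (c ν κ))
    (g := fun i => g i.1 i.2.1 i.2.2) (f := fun i => e i.2.1) (fun i => he.idem _)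
    (fun i => mul_e_of_mem k he (hg i.1 i.2.1 i.2.2))
    (fun i => peirce_le_offDiag i.2.1.2 (hg i.1 i.2.1 i.2.2)) ?_ ?_
  · intro R hR
    refine le_of_le_sup_mul (J := offDiag k e) (R := R.restrictScalars k)
      (N := (Ring.jacobson A).restrictScalars k) ?_ ?_ (isNilpotent_jacobson k A)
    · refine offDiag_le fun κ ν h => (hspan ν ⟨κ, h⟩).trans (sup_le_sup_right ?_ _)
      rw [Submodule.span_le]
      rintro _ ⟨i, rfl⟩
      exact hR ⟨ν, ⟨κ, h⟩, i⟩
    · rw [Submodule.mul_le]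
      intro x hx y _
      exact R.smul_mem (MulOpposite.op y) hx
  · have h1 : Module.finrank k ↥(rightJ hd) = Module.finrank k ↥(leftJ hd) := rfl
    rw [h1, ← sum_cornerDim k he, Fintype.sum_sigma]
    refine Finset.sum_congr rfl fun ν _ => ?_
    rw [hc, Fintype.sum_sigma]
    refine Finset.sum_congr rfl fun κ _ => ?_
    simp

end Right

/-! ### Transport, gluing and refinement of filtrations -/

section Filtration

variable {A : Type v} [Ring A] {M : Type*} [AddCommGroup M] [Module A M]
  {M' : Type*} [AddCommGroup M'] [Module A M']
  {ι : Type*} {X : ι → Type*} [∀ i, AddCommGroup (X i)] [∀ i, Module A (X i)]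

theorem FiltStep.map {f : M →ₗ[A] M'} (hf : Function.Injective f) {N N' : Submodule A M}
    (h : FiltStep X N N') : FiltStep X (N.map f) (N'.map f) := by
  obtain ⟨hN, i, ⟨φ⟩⟩ := h
  refine ⟨Submodule.map_mono hN, i, ⟨LinearEquiv.trans (LinearEquiv.symm
    (Submodule.Quotient.equiv _ _ (Submodule.equivMapOfInjective f hf N') ?_)) φ⟩⟩
  ext ⟨y, hy⟩
  constructor
  · rintro ⟨x, hx, hxy⟩
    exact ⟨x, hx, congrArg Subtype.val hxy⟩
  · rintro ⟨x, hx, hxy⟩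
    exact ⟨⟨x, hN hx⟩, hx, Subtype.ext hxy⟩

theorem FiltStep.comap {f : M →ₗ[A] M'} (hf : Function.Surjective f) {N N' : Submodule A M'}
    (h : FiltStep X N N') : FiltStep X (N.comap f) (N'.comap f) := by
  obtain ⟨hN, i, ⟨φ⟩⟩ := h
  let g : ↥(N'.comap f) →ₗ[A] ↥N' ⧸ N.submoduleOf N' :=
    (N.submoduleOf N').mkQ ∘ₗ f.restrict fun x hx => hx
  have hg : Function.Surjective g := by
    refine (Submodule.mkQ_surjective _).comp ?_
    rintro ⟨y, hy⟩
    obtain ⟨x, rfl⟩ := hf y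
    exact ⟨⟨x, hy⟩, rfl⟩
  have hker : (N.comap f).submoduleOf (N'.comap f) = LinearMap.ker g := by
    ext x
    rw [LinearMap.mem_ker, LinearMap.comp_apply, Submodule.mkQ_apply,
      Submodule.Quotient.mk_eq_zero]
    rfl
  exact ⟨Submodule.comap_mono hN, i,
    ⟨((Submodule.quotEquivOfEq _ _ hker).trans (g.quotKerEquivOfSurjective hg)).trans φ⟩⟩

theorem HasFiltrationBy.congr (ψ : M ≃ₗ[A] M') (h : HasFiltrationBy A M X) :
    HasFiltrationBy A M' X := by
  refine hasFiltrationBy_of_reflTransGen ?_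
  have h1 := h.reflTransGen.lift (Submodule.map (ψ : M →ₗ[A] M'))
    fun _ _ hab => hab.map ψ.injective
  rwa [Function.onFun, Submodule.map_bot, Submodule.map_top, LinearEquiv.range] at h1

theorem hasFiltrationBy_of_subsingleton [Subsingleton M] : HasFiltrationBy A M X := by
  refine hasFiltrationBy_of_reflTransGen ?_
  rw [Subsingleton.elim (⊥ : Submodule A M) ⊤]

theorem hasFiltrationBy_of_surjective {f : M →ₗ[A] M'} (hf : Function.Surjective f)
    (h1 : HasFiltrationBy A ↥(LinearMap.ker f) X) (h2 : HasFiltrationBy A M' X) :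
    HasFiltrationBy A M X := by
  refine hasFiltrationBy_of_reflTransGen ?_
  have h3 := h1.reflTransGen.lift (Submodule.map (LinearMap.ker f).subtype)
    fun _ _ hab => hab.map (LinearMap.ker f).subtype_injective
  have h4 := h2.reflTransGen.lift (Submodule.comap f) fun _ _ hab => hab.comap hf
  rw [Function.onFun, Submodule.map_bot, Submodule.map_subtype_top] at h3
  rw [Function.onFun, Submodule.comap_bot, Submodule.comap_top] at h4
  exact h3.trans h4

theorem hasFiltrationBy_of_quotient (L : Submodule A M) (h1 : HasFiltrationBy A ↥L X)
    (h2 : HasFiltrationBy A (M ⧸ L) X) : HasFiltrationBy A M X :=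
  hasFiltrationBy_of_surjective L.mkQ_surjective
    (h1.congr (LinearEquiv.ofEq _ _ L.ker_mkQ.symm)) h2

theorem hasFiltrationBy_of_equiv (i : ι) (φ : M ≃ₗ[A] X i) : HasFiltrationBy A M X := by
  refine hasFiltrationBy_of_reflTransGen (Relation.ReflTransGen.single ⟨bot_le, i, ⟨?_⟩⟩)
  refine LinearEquiv.trans (Submodule.quotEquivOfEqBot _ ?_) (Submodule.topEquiv.trans φ)
  exact LinearMap.ker_eq_bot.2 (Submodule.subtype_injective _)

/-- Refining a filtration. -/
theorem HasFiltrationBy.refine {κ : Type*} {Y : κ → Type*} [∀ i, AddCommGroup (Y i)]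
    [∀ i, Module A (Y i)] (h : HasFiltrationBy A M X) (hX : ∀ i, HasFiltrationBy A (X i) Y) :
    HasFiltrationBy A M Y := by
  have key : ∀ N : Submodule A M, Relation.ReflTransGen (FiltStep X) ⊥ N →
      HasFiltrationBy A ↥N Y := by
    intro N hN
    induction hN with
    | refl => exact hasFiltrationBy_of_subsingleton
    | @tail N N' _ hstep ih =>
      obtain ⟨hle, i, ⟨φ⟩⟩ := hstep
      exact hasFiltrationBy_of_quotient (N.submoduleOf N')
        (ih.congr (Submodule.submoduleOfEquivOfLe hle).symm) ((hX i).congr φ.symm)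
  exact (key ⊤ h.reflTransGen).congr Submodule.topEquiv

end Filtration

/-! ### Traces in split extensions -/

section Split

variable {A : Type v} [Ring A] {M : Type*} [AddCommGroup M] [Module A M]
  {M' : Type*} [AddCommGroup M'] [Module A M']

theorem map_mem_genBy_top {S : Set A} (f : M →ₗ[A] M') {x : M}
    (hx : x ∈ genBy S (⊤ : Submodule A M)) : f x ∈ genBy S (⊤ : Submodule A M') :=
  genBy_mono subset_rfl le_top ((map_genBy S ⊤ f).le (Submodule.mem_map_of_mem hx))

/-- The projection onto the kernel of a split surjection. -/
def kerRetraction {φ : M →ₗ[A] M'} {s : M' →ₗ[A] M} (hs : φ ∘ₗ s = LinearMap.id) :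
    M →ₗ[A] ↥(LinearMap.ker φ) :=
  (LinearMap.id - s ∘ₗ φ).codRestrict _ fun x => by
    have hs' : φ (s (φ x)) = φ x := LinearMap.congr_fun hs (φ x)
    rw [LinearMap.mem_ker, LinearMap.sub_apply, map_sub, LinearMap.comp_apply, hs',
      LinearMap.id_apply, sub_self]

theorem kerRetraction_apply {φ : M →ₗ[A] M'} {s : M' →ₗ[A] M} (hs : φ ∘ₗ s = LinearMap.id)
    {x : M} (hx : φ x = 0) : (kerRetraction hs x : M) = x := by
  change x - s (φ x) = x
  rw [hx, map_zero, sub_zero]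

/-- Compatibility of `genBy` with split surjections. -/
theorem exists_genBy_surjective (S : Set A) {φ : M →ₗ[A] M'} {s : M' →ₗ[A] M}
    (hs : φ ∘ₗ s = LinearMap.id) :
    ∃ ψ : ↥(genBy S (⊤ : Submodule A M)) →ₗ[A] ↥(genBy S (⊤ : Submodule A M')),
      Function.Surjective ψ ∧ Nonempty (↥(genBy S (⊤ : Submodule A ↥(LinearMap.ker φ))) ≃ₗ[A]
        ↥(LinearMap.ker ψ)) := by
  have hs' : ∀ y, φ (s y) = y := fun y => LinearMap.congr_fun hs y
  let ψ : ↥(genBy S (⊤ : Submodule A M)) →ₗ[A] ↥(genBy S (⊤ : Submodule A M')) :=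
    φ.restrict fun x hx => map_mem_genBy_top φ hx
  let j : ↥(genBy S (⊤ : Submodule A ↥(LinearMap.ker φ))) →ₗ[A] ↥(genBy S (⊤ : Submodule A M)) :=
    (LinearMap.ker φ).subtype.restrict fun x hx => map_mem_genBy_top _ hx
  have hj : Function.Injective j := fun a b hab => Subtype.ext (Subtype.ext
    (congrArg (fun z : ↥(genBy S (⊤ : Submodule A M)) => (z : M)) hab))
  -- The retraction onto `ker φ` preserves traces and fixes every element of `ker φ`.
  have hrange : LinearMap.range j = LinearMap.ker ψ := by
    ext ⟨x, hx⟩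
    constructor
    · rintro ⟨y, hy⟩
      rw [← hy]
      exact LinearMap.mem_ker.2 (Subtype.ext y.1.2)
    · intro h
      have h1 : φ x = 0 := congrArg Subtype.val (LinearMap.mem_ker.1 h)
      exact ⟨⟨_, map_mem_genBy_top (kerRetraction hs) hx⟩,
        Subtype.ext (kerRetraction_apply hs h1)⟩
  refine ⟨ψ, ?_, ⟨(LinearEquiv.ofInjective j hj).trans (LinearEquiv.ofEq _ _ hrange)⟩⟩
  rintro ⟨y, hy⟩
  exact ⟨⟨s y, map_mem_genBy_top s hy⟩, Subtype.ext (hs' y)⟩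

end Split

/-! ### Induction over projective modules and the standard filtration -/

section Induction

variable (k : Type u) [Field k] {A : Type v} [Ring A] [Algebra k A] [FiniteDimensional k A]
  {Λ : Type w} {e : Λ → A}

/-- The submodule of `A e_l` generated by the spaces `e_m A e_l` with `m ≠ l`. -/
abbrev offDiagPart (e : Λ → A) (l : Λ) : Submodule A ↥(ProjMod e l) := genBy (e '' {l}ᶜ) ⊤

theorem smul_mem_offDiagPart {l m : Λ} (h : m ≠ l) (p : ↥(ProjMod e l)) :
    e m • p ∈ offDiagPart e l :=
  smul_mem_genBy (Set.mem_image_of_mem e h) Submodule.mem_top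

/-- The composite of nonzero maps `l → m → l` with `l ≠ m` vanishes. -/
def NoReturn (e : Λ → A) : Prop :=
  ∀ l m : Λ, m ≠ l → ∀ a b : A, e l * (a * (e m * (b * e l))) = 0

/-- Every generator passes through some `e t` with `t ≠ l`, so `NoReturn` applies; an arbitrary left
factor `a` is carried through the span induction. -/
theorem smul_genBy_eq_zero (hprim : ∀ l, IsPrimitiveIdempotent (e l)) (hnr : NoReturn e)
    {l : Λ} {T : Set Λ} (hT : l ∉ T) {p : ↥(ProjMod e l)} (hp : p ∈ genBy (e '' T) ⊤) :
    e l • p = 0 := by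
  have key : ∀ a : A, e l * (a * (p : A)) = 0 := by
    induction hp using Submodule.span_induction with
    | mem y hy =>
      intro a
      obtain ⟨_, ⟨t, ht, rfl⟩, z, -, rfl⟩ := hy
      have := hnr l t (fun h => hT (h ▸ ht)) a z
      rwa [(mem_span_idem (hprim l).1).1 z.2] at this
    | zero => simp
    | add y z _ _ hy hz =>
      intro a
      rw [Submodule.coe_add, mul_add, mul_add, hy, hz, add_zero]
    | smul b y _ hy =>
      intro a
      rw [Submodule.coe_smul, smul_eq_mul, ← mul_assoc a b]
      exact hy (a * b)
  refine Subtype.ext ?_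
  have := key 1
  rwa [one_mul] at this

/-- Provides the drop of dimension from `P_l` to `J e_l` in `projective_induction`: `e l` kills `J
e_l` but not `P_l`. -/
theorem offDiagPart_ne_top (hprim : ∀ l, IsPrimitiveIdempotent (e l)) (hnr : NoReturn e) (l : Λ) :
    offDiagPart e l ≠ ⊤ := by
  intro h
  have h2 : gen (e l) ∈ offDiagPart e l := by
    rw [h]
    exact Submodule.mem_top
  have h1 := smul_genBy_eq_zero hprim hnr (l := l) (T := {l}ᶜ) (by simp) h2
  exact (hprim l).2.1 ((hprim l).1.eq.symm.trans (congrArg Subtype.val h1))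

variable [Fintype Λ]

/-- Induction over finite-dimensional projective modules. -/
theorem projective_induction (he : CompleteOrthogonalIdempotents e)
    (hprim : ∀ l, IsPrimitiveIdempotent (e l)) (hnr : NoReturn e)
    (hJ : ∀ l, Module.Projective A ↥(offDiagPart e l))
    (Q : ∀ (M : Type v) [AddCommGroup M] [Module A M] [Module k M] [IsScalarTower k A M]
      [FiniteDimensional k M], Prop)
    (h0 : ∀ (M : Type v) [AddCommGroup M] [Module A M] [Module k M] [IsScalarTower k A M]
      [FiniteDimensional k M], Subsingleton M → Q M)
    (hsplit : ∀ (M : Type v) [AddCommGroup M] [Module A M] [Module k M] [IsScalarTower k A M]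
      [FiniteDimensional k M] (l : Λ) (φ : M →ₗ[A] ↥(ProjMod e l)) (s : ↥(ProjMod e l) →ₗ[A] M),
      φ ∘ₗ s = LinearMap.id → Q ↥(LinearMap.ker φ) → Q ↥(ProjMod e l) → Q M)
    (hP : ∀ l, Q ↥(offDiagPart e l) → Q ↥(ProjMod e l))
    (M : Type v) [AddCommGroup M] [Module A M] [Module k M] [IsScalarTower k A M]
    [FiniteDimensional k M] [Module.Projective A M] : Q M := by
  suffices H : ∀ (n : ℕ) (M : Type v) [AddCommGroup M] [Module A M] [Module k M]
      [IsScalarTower k A M] [FiniteDimensional k M] [Module.Projective A M],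
      Module.finrank k M = n → Q M from H _ M rfl
  intro n
  induction n using Nat.strong_induction_on with
  | _ n ih =>
    intro M _ _ _ _ _ _ hn
    rcases subsingleton_or_nontrivial M with hM | hM
    · exact h0 M hM
    have : IsNoetherian A M := isNoetherian_of_tower k inferInstance
    -- Some `e l` does not kill a simple quotient of `M`, so `P_l` splits off from `M`. Both the
    -- complement `ker φ` and `J e_l` have smaller dimension than `M`.
    obtain ⟨N, hN, -⟩ := (eq_top_or_exists_le_coatom (⊥ : Submodule A M)).resolve_left bot_ne_top
    obtain ⟨l, x, hx⟩ : ∃ (l : Λ) (x : M), e l • x ∉ N := by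
      by_contra! h
      refine hN.1 (eq_top_iff.2 fun x _ => ?_)
      rw [← one_smul A x, ← he.complete, Finset.sum_smul]
      exact Submodule.sum_mem _ fun l _ => h l x
    obtain ⟨φ, hφ⟩ := exists_surjective_of_notMem (k := k) (hprim l) hN hx
    have := projective_span_idem (hprim l).1
    obtain ⟨s, hs⟩ := LinearMap.exists_rightInverse_of_surjective φ (LinearMap.range_eq_top.2 hφ)
    have hker : Module.Projective A ↥(LinearMap.ker φ) :=
      Module.Projective.of_split (M := M) (LinearMap.ker φ).subtype (kerRetraction hs)
        (LinearMap.ext fun x => Subtype.ext (kerRetraction_apply hs x.2))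
    have hfr : Module.finrank k ↥(ProjMod e l) + Module.finrank k ↥(LinearMap.ker φ) = n := by
      rw [← hn, ← finrank_quotient_add k (LinearMap.ker φ)]
      congr 1
      exact ((φ.quotKerEquivOfSurjective hφ).restrictScalars k).finrank_eq.symm
    have hpos : 0 < Module.finrank k ↥(ProjMod e l) := by
      have := nontrivial_span (hprim l)
      exact Module.finrank_pos
    have hlt : Module.finrank k ↥(offDiagPart e l) < Module.finrank k ↥(ProjMod e l) :=
      Submodule.finrank_lt (s := (offDiagPart e l).restrictScalars k) (by
        rw [Ne, Submodule.restrictScalars_eq_top_iff]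
        exact offDiagPart_ne_top hprim hnr l)
    have := hJ l
    exact hsplit M l φ s hs (ih _ (by omega) _ rfl) (hP l (ih _ (by omega) _ rfl))

include k in
-- The claim is strengthened to traces of all sets `T` in all projective modules. In `P_l` with `l ∉
-- T`, the trace is already the trace in `J e_l`. With `l ∈ T`, it is `P_l`, an extension of `Δ_l`
-- by the trace of the indices above `l`, a set that omits `l`.
theorem hasFiltrationBy_standardMod [IsAlgClosed k] [LinearOrder Λ]
    (he : CompleteOrthogonalIdempotents e)
    (hprim : ∀ l, IsPrimitiveIdempotent (e l)) (hnr : NoReturn e)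
    (hJ : ∀ l, Module.Projective A ↥(offDiagPart e l)) :
    HasFiltrationBy A A (StandardMod e) := by
  have key := projective_induction k he hprim hnr hJ (Q := fun M => ∀ T : Set Λ,
    HasFiltrationBy A ↥(genBy (e '' T) (⊤ : Submodule A M)) (StandardMod e))
    (by
      intro M _ _ _ _ _ hM T
      exact hasFiltrationBy_of_subsingleton)
    (by
      intro M _ _ _ _ _ l φ s hs h1 h2 T
      obtain ⟨ψ, hψ, ⟨θ⟩⟩ := exists_genBy_surjective (e '' T) hs
      exact hasFiltrationBy_of_surjective hψ ((h1 T).congr θ) (h2 T))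
    (by
      intro l h T
      have hout : ∀ T : Set Λ, l ∉ T →
          HasFiltrationBy A ↥(genBy (e '' T) (⊤ : Submodule A ↥(ProjMod e l))) (StandardMod e) := by
        intro T hT
        rw [genBy_eq_of_forall_mem (N := offDiagPart e l) (by
          rintro _ ⟨t, -, rfl⟩
          exact (hprim t).1) le_top (by
          rintro _ ⟨t, ht, rfl⟩ x -
          exact smul_mem_offDiagPart (ne_of_mem_of_not_mem ht hT) x)]
        exact (h T).congr (genByTopEquiv _ _)
      by_cases hl : l ∈ T
      · have htop : genBy (e '' T) (⊤ : Submodule A ↥(ProjMod e l)) = ⊤ := by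
          refine eq_top_iff.2 fun p _ => ?_
          rw [← smul_gen (hprim l).1 p, ← smul_gen (hprim l).1 (gen (e l))]
          exact Submodule.smul_mem _ _
            (smul_mem_genBy (Set.mem_image_of_mem e hl) Submodule.mem_top)
        rw [htop]
        refine HasFiltrationBy.congr Submodule.topEquiv.symm ?_
        refine hasFiltrationBy_of_quotient (standardKer e l) ?_
          (hasFiltrationBy_of_equiv l (LinearEquiv.refl _ _))
        rw [standardKer_eq k hprim]
        exact hout _ (by simp)
      · exact hout T hl)
    A Set.univ
  have htop : genBy (e '' Set.univ) (⊤ : Submodule A A) = ⊤ := by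
    refine eq_top_iff.2 fun x _ => ?_
    rw [← one_mul x, ← he.complete, Finset.sum_mul]
    exact Submodule.sum_mem _ fun l _ =>
      smul_mem_genBy (x := x) (Set.mem_image_of_mem e (Set.mem_univ l)) Submodule.mem_top
  rw [htop] at key
  exact key.congr Submodule.topEquiv

end Induction

/-! ### A dimension formula for quotients of projective modules -/

section DimensionCount

variable (k : Type u) [Field k] {A : Type v} [Ring A] [Algebra k A] [FiniteDimensional k A]
  {Λ : Type w} {e : Λ → A}

omit [FiniteDimensional k A] in
theorem cornerDim_quotient_genBy_split {M M' : Type*} [AddCommGroup M] [Module A M] [Module k M]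
    [IsScalarTower k A M] [FiniteDimensional k M] [AddCommGroup M'] [Module A M'] [Module k M']
    [IsScalarTower k A M'] [FiniteDimensional k M'] {f : A} (hf : IsIdempotentElem f) (S : Set A)
    {φ : M →ₗ[A] M'} {s : M' →ₗ[A] M} (hs : φ ∘ₗ s = LinearMap.id) :
    cornerDim k (M ⧸ genBy S (⊤ : Submodule A M)) f =
      cornerDim k (↥(LinearMap.ker φ) ⧸ genBy S (⊤ : Submodule A ↥(LinearMap.ker φ))) f +
        cornerDim k (M' ⧸ genBy S (⊤ : Submodule A M')) f := by
  obtain ⟨ψ, hψ, ⟨θ⟩⟩ := exists_genBy_surjective S hs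
  have hφ : Function.Surjective φ := fun y => ⟨s y, LinearMap.congr_fun hs y⟩
  have h1 := cornerDim_add k hf (LinearMap.ker φ)
  rw [cornerDim_congr k (φ.quotKerEquivOfSurjective hφ)] at h1
  have h2 := cornerDim_add k hf (LinearMap.ker ψ)
  rw [cornerDim_congr k (ψ.quotKerEquivOfSurjective hψ), ← cornerDim_congr k θ] at h2
  have h3 := cornerDim_add k hf (genBy S (⊤ : Submodule A M))
  have h4 := cornerDim_add k hf (genBy S (⊤ : Submodule A M'))
  have h5 := cornerDim_add k hf (genBy S (⊤ : Submodule A ↥(LinearMap.ker φ)))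
  omega

variable [Fintype Λ] [IsAlgClosed k]

/-- Numerical form of the freeness of `e_l (M / trace)` over the local ring `e_l A e_l`. A summand
`P_m` with `m ∈ T` contributes nothing, and `P_l` contributes `e_l A e_l`, with rank one. For other
`m`, all generators pass through some `e t`, `t ≠ m`, so `P_m` may be replaced by `J e_m`. -/
theorem cornerDim_quotient_eq_mul (he : CompleteOrthogonalIdempotents e)
    (hprim : ∀ l, IsPrimitiveIdempotent (e l)) (hnr : NoReturn e)
    (hJ : ∀ l, Module.Projective A ↥(offDiagPart e l)) {l : Λ} {T : Set Λ} (hT : l ∉ T)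
    (M : Type v) [AddCommGroup M] [Module A M] [Module k M] [IsScalarTower k A M]
    [FiniteDimensional k M] [Module.Projective A M] :
    cornerDim k (M ⧸ genBy (e '' T) (⊤ : Submodule A M)) (e l) =
      cornerDim k ↥(ProjMod e l) (e l) *
        cornerDim k (M ⧸ genBy (e '' T ∪ nilCorner (e l)) (⊤ : Submodule A M)) (e l) := by
  have hidem := (hprim l).1
  refine projective_induction k he hprim hnr hJ (Q := fun M =>
    cornerDim k (M ⧸ genBy (e '' T) (⊤ : Submodule A M)) (e l) =
      cornerDim k ↥(ProjMod e l) (e l) *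
        cornerDim k (M ⧸ genBy (e '' T ∪ nilCorner (e l)) (⊤ : Submodule A M)) (e l)) ?_ ?_ ?_ M
  · intro M _ _ _ _ _ hM
    have hz : ∀ N : Submodule A M, cornerDim k (M ⧸ N) (e l) = 0 := fun N =>
      (cornerDim_eq_zero_iff k hidem).2 fun x => Subsingleton.elim _ _
    rw [hz, hz, mul_zero]
  · intro M _ _ _ _ _ m φ s hs h1 h2
    rw [cornerDim_quotient_genBy_split k hidem _ hs, h1, h2,
      cornerDim_quotient_genBy_split k hidem _ hs, mul_add]
  · intro m h
    by_cases hm : m ∈ T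
    · have htop : ∀ S : Set A, e '' T ⊆ S → genBy S (⊤ : Submodule A ↥(ProjMod e m)) = ⊤ := by
        refine fun S hS => eq_top_iff.2 fun p _ => ?_
        rw [← smul_gen (hprim m).1 p, ← smul_gen (hprim m).1 (gen (e m))]
        exact Submodule.smul_mem _ _
          (smul_mem_genBy (hS (Set.mem_image_of_mem e hm)) Submodule.mem_top)
      have hz : cornerDim k (↥(ProjMod e m) ⧸ (⊤ : Submodule A ↥(ProjMod e m))) (e l) = 0 :=
        (cornerDim_eq_zero_iff k hidem).2 fun x => Subsingleton.elim _ _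
      rw [htop _ subset_rfl, htop _ Set.subset_union_left, hz, mul_zero]
    by_cases hml : m = l
    · subst hml
      have hz : cornerDim k ↥(genBy (e '' T) (⊤ : Submodule A ↥(ProjMod e m))) (e m) = 0 := by
        refine (cornerDim_eq_zero_iff k hidem).2 ?_
        rintro ⟨p, hp⟩
        exact Subtype.ext (smul_genBy_eq_zero hprim hnr hT hp)
      rw [cornerDim_quotient_genBy k hprim m, mul_one,
        cornerDim_add (M := ↥(ProjMod e m)) k hidem (genBy (e '' T) ⊤), hz, zero_add]
      · rintro _ ⟨t, ht, rfl⟩ x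
        -- An element outside the radical generates `P_m`, so the trace would be all of `P_m`,
        -- although `e m` kills it.
        by_contra hx
        have h1 : Submodule.span A {e t • x} = ⊤ := by
          by_contra h2
          exact hx (le_jacobson_of_ne_top (k := k) (hprim m) h2
            (Submodule.mem_span_singleton_self _))
        have h2 : genBy (e '' T) (⊤ : Submodule A ↥(ProjMod e m)) = ⊤ := by
          refine eq_top_iff.2 (h1.symm.le.trans ?_)
          rw [Submodule.span_singleton_le_iff_mem]
          exact smul_mem_genBy (Set.mem_image_of_mem e ht) Submodule.mem_top
        have h3 := smul_genBy_eq_zero hprim hnr hT (p := gen (e m)) (by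
          rw [h2]
          exact Submodule.mem_top)
        exact (hprim m).2.1 (hidem.eq.symm.trans (congrArg Subtype.val h3))
    · have key : ∀ S : Set A, (∀ s ∈ S, ∃ t, t ≠ m ∧ e t * s = s ∧ s * e t = s) →
          cornerDim k (↥(ProjMod e m) ⧸ genBy S (⊤ : Submodule A ↥(ProjMod e m))) (e l) =
            cornerDim k (↥(offDiagPart e m) ⧸
              genBy S (⊤ : Submodule A ↥(offDiagPart e m))) (e l) := by
        intro S hS
        have h1 := cornerDim_add k hidem (genBy S (⊤ : Submodule A ↥(ProjMod e m)))
        have h2 := cornerDim_add k hidem (genBy S (⊤ : Submodule A ↥(offDiagPart e m)))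
        have h3 : genBy S (⊤ : Submodule A ↥(ProjMod e m)) = genBy S (offDiagPart e m) := by
          refine le_antisymm (genBy_le fun s hs x _ => ?_) (genBy_mono subset_rfl le_top)
          obtain ⟨t, ht, h3, h4⟩ := hS s hs
          rw [← h4, mul_smul]
          exact smul_mem_genBy hs (smul_mem_offDiagPart ht x)
        have h4 : cornerDim k ↥(ProjMod e m) (e l) = cornerDim k ↥(offDiagPart e m) (e l) := by
          rw [← cornerDim_top_submodule]
          refine cornerDim_sub_eq k _ _ fun x hx => ⟨fun _ => ?_, fun _ => Submodule.mem_top⟩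
          rw [← hx]
          exact smul_mem_offDiagPart (Ne.symm hml) x
        have h5 : cornerDim k ↥(genBy S (⊤ : Submodule A ↥(offDiagPart e m))) (e l) =
            cornerDim k ↥(genBy S (offDiagPart e m)) (e l) :=
          cornerDim_congr k (genByTopEquiv S (offDiagPart e m)) (e l)
        rw [← h3] at h5
        omega
      rw [key, key, h]
      · rintro s (⟨t, ht, rfl⟩ | hs)
        · exact ⟨t, ne_of_mem_of_not_mem ht hm, (hprim t).1.eq, (hprim t).1.eq⟩
        · exact ⟨l, Ne.symm hml, hs.1, hs.2.1⟩
      · rintro _ ⟨t, ht, rfl⟩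
        exact ⟨t, ne_of_mem_of_not_mem ht hm, (hprim t).1.eq, (hprim t).1.eq⟩

end DimensionCount

/-! ### Passage to the opposite algebra -/

section Opposite

variable (k : Type u) [Field k] {A : Type v} [Ring A] [Algebra k A] {Λ : Type w} {e : Λ → A}

open MulOpposite

theorem isPrimitiveIdempotent_op {f : A} (hf : IsPrimitiveIdempotent f) :
    IsPrimitiveIdempotent (op f) := by
  refine ⟨congrArg op hf.1.eq, fun h => hf.2.1 (op_injective h), fun g h hg hh hgh hhg hsum => ?_⟩
  rcases hf.2.2 g.unop h.unop (congrArg unop hg.eq) (congrArg unop hh.eq) (congrArg unop hhg)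
    (congrArg unop hgh) (congrArg unop hsum) with h1 | h1
  · exact Or.inl (unop_injective h1)
  · exact Or.inr (unop_injective h1)

theorem completeOrthogonalIdempotents_op [Fintype Λ] (he : CompleteOrthogonalIdempotents e) :
    CompleteOrthogonalIdempotents fun l => op (e l) where
  idem l := congrArg op (he.idem l).eq
  ortho l m h := congrArg op (he.ortho (Ne.symm h))
  complete := by rw [← Finset.op_sum, he.complete, op_one]

theorem noReturn_op (h : NoReturn e) : NoReturn fun l => op (e l) := by
  intro l m hlm a b
  apply unop_injective
  have := h l m hlm b.unop a.unop
  simpa [mul_assoc] using this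

theorem op_image_nilCorner (f : A) : nilCorner (op f) = op '' nilCorner f := by
  ext x
  constructor
  · rintro ⟨h1, h2, n, hn⟩
    exact ⟨x.unop, ⟨congrArg unop h2, congrArg unop h1, n, congrArg unop hn⟩, rfl⟩
  · rintro ⟨x, ⟨h1, h2, n, hn⟩, rfl⟩
    exact ⟨congrArg op h2, congrArg op h1, n, congrArg op hn⟩

/-- The trace in the opposite regular module is the two-sided ideal `A S A`, whose intersection with
`A f` is `A S A f`. -/
theorem op_mem_genBy_iff {f : A} (hf : IsIdempotentElem f) (S : Set A)
    (p : ↥(Submodule.span A {f})) :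
    op (p : A) ∈ genBy (op '' S) (⊤ : Submodule Aᵐᵒᵖ Aᵐᵒᵖ) ↔
      p ∈ genBy S (⊤ : Submodule A ↥(Submodule.span A {f})) := by
  constructor
  · intro h
    have key : ∀ y ∈ genBy (op '' S) (⊤ : Submodule Aᵐᵒᵖ Aᵐᵒᵖ), ∀ q : ↥(Submodule.span A {f}),
        y.unop • q ∈ genBy S (⊤ : Submodule A ↥(Submodule.span A {f})) := by
      intro y hy
      induction hy using Submodule.span_induction with
      | mem y hy =>
        obtain ⟨_, ⟨s, hs, rfl⟩, x, -, rfl⟩ := hy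
        intro q
        rw [smul_eq_mul, unop_mul, unop_op, mul_smul]
        exact Submodule.smul_mem _ _ (smul_mem_genBy hs Submodule.mem_top)
      | zero => intro q; simp
      | add y z _ _ hy hz =>
        intro q
        rw [unop_add, add_smul]
        exact Submodule.add_mem _ (hy q) (hz q)
      | smul b y _ hy =>
        intro q
        rw [smul_eq_mul, unop_mul, mul_smul]
        exact hy _
    have := key _ h (gen f)
    rwa [unop_op, smul_gen hf] at this
  · intro h
    have key : ∀ b : Aᵐᵒᵖ, op (p : A) * b ∈ genBy (op '' S) (⊤ : Submodule Aᵐᵒᵖ Aᵐᵒᵖ) := by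
      induction h using Submodule.span_induction with
      | mem y hy =>
        obtain ⟨s, hs, x, -, rfl⟩ := hy
        intro b
        rw [Submodule.coe_smul, smul_eq_mul, op_mul, mul_assoc]
        exact Submodule.smul_mem _ _
          (smul_mem_genBy (x := b) (Set.mem_image_of_mem op hs) Submodule.mem_top)
      | zero => intro b; simp
      | add y z _ _ hy hz =>
        intro b
        rw [Submodule.coe_add, op_add, add_mul]
        exact Submodule.add_mem _ (hy b) (hz b)
      | smul a y _ hy =>
        intro b
        rw [Submodule.coe_smul, smul_eq_mul, op_mul, mul_assoc]
        exact hy _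
    have := key 1
    rwa [mul_one] at this

/-- The `op f`-part of the quotient by `A S A` is `(A / A S A) f = A f / A S A f`. Multiplicities
over the opposite algebra thus become full dimensions of standard and proper standard modules. -/
theorem cornerDim_op_quotient {f : A} (hf : IsIdempotentElem f) (S : Set A) :
    cornerDim k (Aᵐᵒᵖ ⧸ genBy (op '' S) (⊤ : Submodule Aᵐᵒᵖ Aᵐᵒᵖ)) (op f) =
      Module.finrank k (↥(Submodule.span A {f}) ⧸
        genBy S (⊤ : Submodule A ↥(Submodule.span A {f}))) := by
  set G := genBy (op '' S) (⊤ : Submodule Aᵐᵒᵖ Aᵐᵒᵖ)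
  set K := genBy S (⊤ : Submodule A ↥(Submodule.span A {f}))
  let θ : ↥(Submodule.span A {f}) →ₗ[k] Aᵐᵒᵖ ⧸ G :=
    (G.mkQ.restrictScalars k) ∘ₗ (opLinearEquiv k : A ≃ₗ[k] Aᵐᵒᵖ).toLinearMap ∘ₗ
      ((Submodule.span A {f}).subtype.restrictScalars k)
  have hθ : ∀ p, θ p = G.mkQ (op (p : A)) := fun p => rfl
  have hrange : LinearMap.range θ = fixedBy k (Aᵐᵒᵖ ⧸ G) (op f) := by
    ext x
    constructor
    · rintro ⟨p, rfl⟩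
      rw [mem_fixedBy, hθ, ← map_smul, smul_eq_mul, ← op_mul, (mem_span_idem hf).1 p.2]
    · intro hx
      obtain ⟨b, rfl⟩ := G.mkQ_surjective x
      refine ⟨b.unop • gen f, ?_⟩
      rw [hθ]
      rw [mem_fixedBy, ← map_smul] at hx
      exact hx
  have hker : LinearMap.ker θ = K.restrictScalars k := by
    ext p
    rw [LinearMap.mem_ker, hθ, Submodule.mkQ_apply, Submodule.Quotient.mk_eq_zero,
      op_mem_genBy_iff hf]
    rfl
  rw [cornerDim, ← hrange, ← θ.quotKerEquivRange.finrank_eq, hker]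
  rfl

theorem cornerDim_span_op {f : A} (hf : IsIdempotentElem f) :
    cornerDim k ↥(Submodule.span Aᵐᵒᵖ {op f}) (op f) =
      cornerDim k ↥(Submodule.span A {f}) f := by
  have hf' : IsIdempotentElem (op f) := congrArg op hf.eq
  refine LinearEquiv.finrank_eq
    { toFun := fun x => ⟨⟨(x : ↥(Submodule.span Aᵐᵒᵖ {op f})).1.unop, ?_⟩, ?_⟩
      invFun := fun x => ⟨⟨op (x : ↥(Submodule.span A {f})).1, ?_⟩, ?_⟩
      map_add' := fun _ _ => rfl
      map_smul' := fun _ _ => rfl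
      left_inv := fun _ => rfl
      right_inv := fun _ => rfl }
  · rw [mem_span_idem hf]
    exact congrArg unop (congrArg Subtype.val x.2)
  · exact Subtype.ext (congrArg unop ((mem_span_idem hf').1 x.1.2))
  · rw [mem_span_idem hf']
    exact congrArg op (congrArg Subtype.val x.2)
  · exact Subtype.ext (congrArg op ((mem_span_idem hf).1 x.1.2))

end Opposite

/-! ### Filtering by proper standard modules through an extremal dimension -/

section ProperStandard

variable (k : Type u) [Field k] {A : Type v} [Ring A] [Algebra k A] [FiniteDimensional k A]
  {f : A}

variable {Y : Type*} [AddCommGroup Y] [Module A Y] [Module k Y] [IsScalarTower k A Y]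
  [FiniteDimensional k Y]

theorem genBy_singleton_genBy (hf : IsIdempotentElem f) (N : Submodule A Y) :
    genBy {f} (genBy {f} N) = genBy {f} N := by
  refine le_antisymm (genBy_le_self _ _) (genBy_le fun s hs x hx => ?_)
  have h := smul_mem_genBy (Set.mem_singleton f) (smul_mem_genBy (Set.mem_singleton f) hx)
  rw [Set.mem_singleton_iff.1 hs]
  rwa [← mul_smul, hf.eq] at h

variable [IsAlgClosed k]

/-- A nonzero submodule generated by its `f`-part is an extension of a quotient of
`A f / (S ∪ nilCorner f)` by a submodule which is generated by its `f`-part, the dimension of which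
is smaller by one. -/
theorem exists_smaller_genBy (hf : IsPrimitiveIdempotent f) {S : Set A}
    (hS : ∀ s ∈ S, ∀ y : Y, s • y = 0) {Z : Submodule A Y} (hZ : genBy {f} Z = Z) (hZ0 : Z ≠ ⊥) :
    ∃ Z' ≤ Z, genBy {f} Z' = Z' ∧ cornerDim k ↥Z f = cornerDim k ↥Z' f + 1 ∧
      ∃ g : (↥(Submodule.span A {f}) ⧸ genBy (S ∪ nilCorner f)
        (⊤ : Submodule A ↥(Submodule.span A {f}))) →ₗ[A] ↥Z ⧸ Z'.submoduleOf Z,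
        Function.Surjective g := by
  have hnt : Nontrivial ↥Z := Submodule.nontrivial_iff_ne_bot.2 hZ0
  have : IsNoetherian A ↥Z := isNoetherian_of_tower k inferInstance
  obtain ⟨N, hN, -⟩ := (eq_top_or_exists_le_coatom (⊥ : Submodule A ↥Z)).resolve_left bot_ne_top
  have hsim : IsSimpleModule A (↥Z ⧸ N) := isSimpleModule_iff_isCoatom.2 hN
  obtain ⟨z, hz⟩ : ∃ z : ↥Z, f • z ∉ N := by
    by_contra! h
    refine hN.1 (eq_top_iff.2 fun z _ => ?_)
    have h1 : genBy {f} Z ≤ N.map Z.subtype := by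
      refine genBy_le ?_
      rintro _ rfl y hy
      exact ⟨_, h ⟨y, hy⟩, rfl⟩
    obtain ⟨z', hz', hzz⟩ := h1 (hZ.symm ▸ z.2 : (z : Y) ∈ genBy {f} Z)
    rwa [← Subtype.ext hzz]
  set x : ↥Z := f • z
  have hfx : f • x = x := by
    change f • f • z = f • z
    rw [← mul_smul, hf.1.eq]
  have hx0 : N.mkQ x ≠ 0 := fun h => hz ((Submodule.Quotient.mk_eq_zero N).1 h)
  have hdim : cornerDim k (↥Z ⧸ N) f = 1 := by
    rw [cornerDim_of_simple k hf, if_pos]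
    rw [nonempty_equiv_top_iff (k := k) hf]
    exact ⟨N.mkQ z, by rw [← map_smul]; exact hx0⟩
  -- `Z'` has the same `f`-part as the maximal submodule `N`, so the `f`-part of `Z / Z'` is still
  -- one-dimensional.
  set Z' : Submodule A Y := genBy {f} (N.map Z.subtype)
  have hZ'N : Z' ≤ N.map Z.subtype := genBy_le_self _ _
  have hZ'Z : Z' ≤ Z := hZ'N.trans (Submodule.map_subtype_le _ _)
  have hmem : ∀ y : ↥Z, y ∈ N → f • y = y → y ∈ Z'.submoduleOf Z := by
    intro y hy hfy
    change (y : Y) ∈ Z'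
    have h1 : f • (y : Y) = y := congrArg Subtype.val hfy
    rw [← h1]
    exact smul_mem_genBy (Set.mem_singleton _) (Submodule.mem_map_of_mem (f := Z.subtype) hy)
  let g₀ : ↥(Submodule.span A {f}) →ₗ[A] ↥Z ⧸ Z'.submoduleOf Z :=
    evalAt f ((Z'.submoduleOf Z).mkQ x)
  have hg₀ : ∀ p, g₀ p = (Z'.submoduleOf Z).mkQ ((p : A) • x) := fun p => rfl
  -- `S` kills `Y`; a nilpotent element of `f A f` sends `x` into `N`, where vectors fixed by `f`
  -- lie in `Z'`.
  have hker : genBy (S ∪ nilCorner f) ⊤ ≤ LinearMap.ker g₀ := by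
    refine genBy_le ?_
    rintro s (hs | hs) p -
    · rw [LinearMap.mem_ker, hg₀, Submodule.coe_smul, smul_eq_mul, mul_smul]
      have : s • ((p : A) • x) = 0 := Subtype.ext (hS s hs _)
      rw [this, map_zero]
    · rw [LinearMap.mem_ker, hg₀, Submodule.mkQ_apply, Submodule.Quotient.mk_eq_zero]
      refine hmem _ ?_ ?_
      · have h1 : evalAt f (N.mkQ x) ≠ 0 := fun h => hx0 (by
          have h2 := LinearMap.congr_fun h (gen f)
          rwa [evalAt_apply, coe_gen, ← map_smul, hfx] at h2)
        have h3 : s • p ∈ LinearMap.ker (evalAt f (N.mkQ x)) := by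
          rw [ker_eq_jacobson (k := k) hf h1]
          exact nilCorner_smul_mem_jacobson (e := fun _ : Unit => f) (l := ()) k
            (fun _ => hf) hs p
        exact (Submodule.Quotient.mk_eq_zero N).1 (LinearMap.mem_ker.1 h3)
      · rw [Submodule.coe_smul, smul_eq_mul, ← mul_smul, ← mul_assoc, hs.1]
  have hsurj : Function.Surjective g₀ := by
    rw [← LinearMap.range_eq_top]
    -- The `f`-part of `Z / N` is the line through `x`, so `f • y` is a scalar multiple of `x` up to
    -- a vector of `N` fixed by `f`.
    have h1 : ∀ y : ↥Z, ∃ a : A, f • y - a • x ∈ Z'.submoduleOf Z := by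
      intro y
      have h2 : N.mkQ (f • y) ∈ fixedBy k (↥Z ⧸ N) f := by
        rw [mem_fixedBy, ← map_smul, ← mul_smul, hf.1.eq]
      have h3 : N.mkQ x ∈ fixedBy k (↥Z ⧸ N) f := by
        rw [mem_fixedBy, ← map_smul, hfx]
      obtain ⟨c, hc⟩ := (finrank_eq_one_iff_of_nonzero' (⟨_, h3⟩ : ↥(fixedBy k (↥Z ⧸ N) f))
        fun h => hx0 (congrArg Subtype.val h)).1 hdim ⟨_, h2⟩
      have hc' : c • N.mkQ x = N.mkQ (f • y) := congrArg Subtype.val hc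
      refine ⟨algebraMap k A c, hmem _ ?_ ?_⟩
      · rw [← Submodule.Quotient.mk_eq_zero, ← Submodule.mkQ_apply, map_sub, ← hc',
          sub_eq_zero, map_smul N.mkQ (algebraMap k A c) x, algebraMap_smul]
      · rw [smul_sub, ← mul_smul, hf.1.eq, ← mul_smul, ← Algebra.commutes, mul_smul, hfx]
    have h2 : Z ≤ ((LinearMap.range g₀).comap (Z'.submoduleOf Z).mkQ).map Z.subtype := by
      conv_lhs => rw [← hZ]
      refine genBy_le ?_
      intro s hs y hy
      rw [Set.mem_singleton_iff.1 hs]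
      refine ⟨f • ⟨y, hy⟩, ?_, rfl⟩
      obtain ⟨a, ha⟩ := h1 ⟨y, hy⟩
      refine ⟨a • gen f, ?_⟩
      rw [hg₀, Submodule.coe_smul, coe_gen, smul_eq_mul, mul_smul, hfx]
      exact ((Submodule.Quotient.eq _).2 ha).symm
    refine eq_top_iff.2 fun y _ => ?_
    obtain ⟨y, rfl⟩ := Submodule.mkQ_surjective _ y
    obtain ⟨y', hy', hyy⟩ := h2 y.2
    rwa [← Subtype.ext hyy]
  refine ⟨Z', hZ'Z, genBy_singleton_genBy hf.1 _, ?_, Submodule.liftQ _ g₀ hker, ?_⟩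
  · rw [cornerDim_add k hf.1 N, hdim]
    congr 1
    rw [← cornerDim_congr k (Submodule.submoduleOfEquivOfLe hZ'Z)]
    refine cornerDim_sub_eq k _ _ fun y hy => ⟨fun h => hmem y h hy, fun h => ?_⟩
    obtain ⟨y', hy', hyy⟩ := hZ'N h
    rwa [← Subtype.ext hyy]
  · intro y
    obtain ⟨p, rfl⟩ := hsurj y
    exact ⟨Submodule.mkQ _ p, rfl⟩

/-- Iterating `exists_smaller_genBy` gives `n` factors, each a quotient of a module of dimension
`c`. If the total dimension is `n * c`, no factor can be smaller and every surjection is an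
isomorphism. -/
theorem finrank_le_and_filtration (hf : IsPrimitiveIdempotent f) {S : Set A}
    (hS : ∀ s ∈ S, ∀ y : Y, s • y = 0) {ι : Type*} {X : ι → Type*} [∀ i, AddCommGroup (X i)]
    [∀ i, Module A (X i)] (i : ι)
    (φ : (↥(Submodule.span A {f}) ⧸ genBy (S ∪ nilCorner f)
      (⊤ : Submodule A ↥(Submodule.span A {f}))) ≃ₗ[A] X i) (n : ℕ) :
    ∀ Z : Submodule A Y, genBy {f} Z = Z → cornerDim k ↥Z f = n →
      Module.finrank k ↥Z ≤ n * Module.finrank k (↥(Submodule.span A {f}) ⧸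
        genBy (S ∪ nilCorner f) (⊤ : Submodule A ↥(Submodule.span A {f}))) ∧
      (Module.finrank k ↥Z = n * Module.finrank k (↥(Submodule.span A {f}) ⧸
        genBy (S ∪ nilCorner f) (⊤ : Submodule A ↥(Submodule.span A {f}))) →
        Relation.ReflTransGen (FiltStep X) ⊥ Z) := by
  set c := Module.finrank k (↥(Submodule.span A {f}) ⧸
        genBy (S ∪ nilCorner f) (⊤ : Submodule A ↥(Submodule.span A {f})))
  induction n with
  | zero =>
    intro Z hZ hn
    have hbot : Z = ⊥ := by
      rw [← hZ]
      refine le_bot_iff.1 (genBy_le ?_)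
      rintro _ rfl y hy
      exact congrArg Subtype.val ((cornerDim_eq_zero_iff k hf.1).1 hn ⟨y, hy⟩)
    subst hbot
    exact ⟨Module.finrank_zero_of_subsingleton.le.trans (Nat.zero_le _),
      fun _ => Relation.ReflTransGen.refl⟩
  | succ n ih =>
    intro Z hZ hn
    have hZ0 : Z ≠ ⊥ := by
      rintro rfl
      rw [(cornerDim_eq_zero_iff k hf.1).2 fun x => Subsingleton.elim _ _] at hn
      omega
    obtain ⟨Z', hle, hZ', hdim, g, hg⟩ := exists_smaller_genBy k hf hS hZ hZ0
    obtain ⟨ih1, ih2⟩ := ih Z' hZ' (by omega)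
    have h1 := finrank_add_submoduleOf k hle
    have h2 : Module.finrank k (↥Z ⧸ Z'.submoduleOf Z) ≤ c :=
      LinearMap.finrank_le_finrank_of_surjective (f := g.restrictScalars k) hg
    rw [Nat.succ_mul]
    refine ⟨by omega, fun heq => (ih2 (by omega)).tail ⟨hle, i, ⟨?_⟩⟩⟩
    have hinj : Function.Injective g :=
      (LinearMap.injective_iff_surjective_of_finrank_eq_finrank (f := g.restrictScalars k)
        (show c = _ by omega)).2 hg
    exact (LinearEquiv.ofBijective g ⟨hinj, hg⟩).symm.trans φ

end ProperStandard

/-! ### From directedness and projectivity of `J` to proper stratification -/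

section Backward

variable (k : Type u) [Field k] {A : Type v} [Ring A] [Algebra k A] [FiniteDimensional k A]
  {Λ : Type w} [Fintype Λ] {e : Λ → A} [IsAlgClosed k]

open MulOpposite

include k in
-- It suffices to filter each `Δ_l`. The formula over the opposite algebra, where right projectivity
-- enters, gives `dim Δ_l = dim (e_l A e_l) * dim Δ̄_l`. As `e_l` kills the trace, `dim e_l Δ_l =
-- dim e_l A e_l`, and the extremal case of `finrank_le_and_filtration` applies.
theorem hasFiltrationBy_properStandardMod [LinearOrder Λ] (he : CompleteOrthogonalIdempotents e)
    (hprim : ∀ l, IsPrimitiveIdempotent (e l)) (hbasic : IsBasic e) (hnr : NoReturn e)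
    (hJ : ∀ l, Module.Projective A ↥(offDiagPart e l))
    (hJop : ∀ l, Module.Projective Aᵐᵒᵖ ↥(offDiagPart (fun l => op (e l)) l)) :
    HasFiltrationBy A A (ProperStandardMod e) := by
  refine (hasFiltrationBy_standardMod k he hprim hnr hJ).refine fun l => ?_
  have hidem := (hprim l).1
  have hop := cornerDim_quotient_eq_mul k (completeOrthogonalIdempotents_op he)
    (fun l => isPrimitiveIdempotent_op (hprim l)) (noReturn_op hnr) hJop
    (l := l) (T := Set.Ioi l) (by simp) Aᵐᵒᵖ
  have himg : (fun l => op (e l)) '' Set.Ioi l = op '' (e '' Set.Ioi l) := by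
    rw [Set.image_image]
  rw [himg, op_image_nilCorner, ← Set.image_union, cornerDim_op_quotient k hidem,
    cornerDim_op_quotient k hidem, cornerDim_span_op k hidem] at hop
  have hS : ∀ s ∈ e '' Set.Ioi l, ∀ y : ↥(ProjMod e l) ⧸
      genBy (e '' Set.Ioi l) (⊤ : Submodule A ↥(ProjMod e l)), s • y = 0 := by
    intro s hs y
    obtain ⟨p, rfl⟩ := Submodule.mkQ_surjective _ y
    exact (Submodule.Quotient.mk_eq_zero _).2 (smul_mem_genBy hs Submodule.mem_top)
  have hd : cornerDim k ↥(⊤ : Submodule A (↥(ProjMod e l) ⧸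
      genBy (e '' Set.Ioi l) (⊤ : Submodule A ↥(ProjMod e l)))) (e l) =
      cornerDim k ↥(ProjMod e l) (e l) := by
    have hz : cornerDim k ↥(genBy (e '' Set.Ioi l) (⊤ : Submodule A ↥(ProjMod e l))) (e l) = 0 := by
      refine (cornerDim_eq_zero_iff k hidem).2 ?_
      rintro ⟨p, hp⟩
      exact Subtype.ext (smul_genBy_eq_zero hprim hnr (by simp) hp)
    rw [cornerDim_top_submodule, cornerDim_add (M := ↥(ProjMod e l)) k hidem
      (genBy (e '' Set.Ioi l) ⊤), hz, zero_add]
  have htop : genBy {e l} (⊤ : Submodule A (↥(ProjMod e l) ⧸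
      genBy (e '' Set.Ioi l) (⊤ : Submodule A ↥(ProjMod e l)))) = ⊤ := by
    refine eq_top_iff.2 fun y _ => ?_
    obtain ⟨p, rfl⟩ := Submodule.mkQ_surjective _ y
    rw [← smul_gen hidem p, ← smul_gen hidem (gen (e l)), coe_gen, map_smul, map_smul]
    exact Submodule.smul_mem _ _ (smul_mem_genBy (Set.mem_singleton _) Submodule.mem_top)
  have φ : (↥(ProjMod e l) ⧸ genBy (e '' Set.Ioi l ∪ nilCorner (e l))
      (⊤ : Submodule A ↥(ProjMod e l))) ≃ₗ[A] ProperStandardMod e l :=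
    Submodule.quotEquivOfEq _ _ (properStandardKer_eq k hprim hbasic l).symm
  have key := (finrank_le_and_filtration k (hprim l) hS (X := ProperStandardMod e) l φ _ ⊤ htop
    hd).2 (by
      rw [← hop]
      exact (Submodule.topEquiv.restrictScalars k).finrank_eq)
  exact (hasFiltrationBy_of_reflTransGen key).congr
    (Submodule.quotEquivOfEq _ _ (standardKer_eq k hprim l).symm)

omit [FiniteDimensional k A] [IsAlgClosed k] in
variable {k} in
theorem noReturn_of_isDirected {he : CompleteOrthogonalIdempotents e}
    (hd : IsDirectedCategory (AssocCat k he)) : NoReturn e := by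
  intro l m hml a b
  have := mul_eq_zero_of_isDirected hd (Ne.symm hml) (x := e m * (b * e l)) (y := e l * (a * e m))
    ((mem_peirce k).2 ⟨b, rfl⟩) ((mem_peirce k).2 ⟨a, rfl⟩)
  rw [← (he.idem m).eq]
  simpa only [mul_assoc] using this

omit [FiniteDimensional k A] [IsAlgClosed k] in
variable {k} in
-- `J e_l` is a retract of `J` under right multiplication by `e l`.
theorem projective_offDiagPart {he : CompleteOrthogonalIdempotents e}
    (hd : IsDirectedCategory (AssocCat k he)) [Module.Projective A ↥(leftJ hd)] (l : Λ) :
    Module.Projective A ↥(offDiagPart e l) := by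
  have h1 : ∀ p ∈ offDiagPart e l, (ProjMod e l).subtype p ∈ leftJ hd := by
    have h : offDiagPart e l ≤ (leftJ hd).comap (ProjMod e l).subtype := by
      refine genBy_le ?_
      rintro _ ⟨t, ht, rfl⟩ p -
      refine peirce_le_offDiag (Ne.symm ht) ((mem_peirce k).2 ⟨p, ?_⟩)
      rw [(mem_span_idem (he.idem l)).1 p.2]
      rfl
    exact fun p hp => h hp
  have h2 : ∀ x ∈ leftJ hd, LinearMap.toSpanSingleton A _ (gen (e l)) x ∈ offDiagPart e l := by
    intro x hx
    have h3 := mul_mem_genBy_of_mem_offDiag k he hx l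
    have h4 := map_mem_genBy_top (LinearMap.toSpanSingleton A _ (gen (e l))) h3
    rwa [LinearMap.toSpanSingleton_apply, mul_smul,
      show e l • gen (e l) = gen (e l) from smul_gen (he.idem l) (gen (e l))] at h4
  refine Module.Projective.of_split (M := ↥(leftJ hd)) ((ProjMod e l).subtype.restrict h1)
    ((LinearMap.toSpanSingleton A _ (gen (e l))).restrict h2) ?_
  exact LinearMap.ext fun p => Subtype.ext (smul_gen (he.idem l) p.1)

omit [FiniteDimensional k A] [IsAlgClosed k] in
variable {k} in
-- Over the opposite algebra the part in question is `e_l J`, a retract of `J` under left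
-- multiplication by `e l`.
theorem projective_offDiagPart_op {he : CompleteOrthogonalIdempotents e}
    (hd : IsDirectedCategory (AssocCat k he)) [Module.Projective Aᵐᵒᵖ ↥(rightJ hd)] (l : Λ) :
    Module.Projective Aᵐᵒᵖ ↥(offDiagPart (fun l => op (e l)) l) := by
  set e' : Λ → Aᵐᵒᵖ := fun l => op (e l)
  have he' := completeOrthogonalIdempotents_op he
  let i : ↥(ProjMod e' l) →ₗ[Aᵐᵒᵖ] A := (opEquiv A).symm.toLinearMap ∘ₗ (ProjMod e' l).subtype
  let q : A →ₗ[Aᵐᵒᵖ] ↥(ProjMod e' l) :=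
    LinearMap.toSpanSingleton Aᵐᵒᵖ _ (gen (e' l)) ∘ₗ (opEquiv A).toLinearMap
  have hi : ∀ p, i p = (p : Aᵐᵒᵖ).unop := fun p => rfl
  have hq : ∀ x, (q x : Aᵐᵒᵖ) = op (e l * x) := fun x => rfl
  have h1 : ∀ p ∈ offDiagPart e' l, i p ∈ rightJ hd := by
    have h : offDiagPart e' l ≤ (rightJ hd).comap i := by
      refine genBy_le ?_
      rintro _ ⟨t, ht, rfl⟩ p -
      refine peirce_le_offDiag ht ((mem_peirce k).2 ⟨(p : Aᵐᵒᵖ).unop, ?_⟩)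
      have h3 := congrArg unop ((mem_span_idem (he'.idem l)).1 p.2)
      rw [unop_mul, unop_op] at h3
      rw [← mul_assoc, h3]
      rfl
    exact fun p hp => h hp
  have h2 : ∀ x ∈ rightJ hd, q x ∈ offDiagPart e' l := by
    suffices h : ∀ x ∈ offDiag k e, q x ∈ offDiagPart e' l from h
    have h : offDiag k e ≤
        ((offDiagPart e' l).restrictScalars k).comap (q.restrictScalars k) := by
      refine offDiag_le fun m n hmn y hy => ?_
      change q y ∈ offDiagPart e' l
      by_cases hl : n = l
      · subst hl
        have h3 : q y = e' m • q y := by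
          refine Subtype.ext ?_
          rw [Submodule.coe_smul, hq, smul_eq_mul, ← op_mul, mul_assoc, mul_e_of_mem k he hy]
        rw [h3]
        exact smul_mem_offDiagPart hmn _
      · have h3 : q y = 0 := by
          refine Subtype.ext ?_
          rw [hq, ← e_mul_of_mem k he hy, ← mul_assoc, he.ortho (Ne.symm hl), zero_mul]
          rfl
        rw [h3]
        exact Submodule.zero_mem _
    exact fun x hx => h hx
  refine Module.Projective.of_split (M := ↥(rightJ hd)) (i.restrict h1) (q.restrict h2) ?_
  refine LinearMap.ext fun p => Subtype.ext (Subtype.ext ?_)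
  change (q (i p.1) : Aᵐᵒᵖ) = p.1.1
  rw [hq, hi, op_mul, op_unop]
  exact (mem_span_idem (he'.idem l)).1 p.1.2

end Backward

end StratAlg

theorem corollary1p9 {k : Type*} [Field k] [IsAlgClosed k]
    {A : Type*} [Ring A] [Algebra k A] [FiniteDimensional k A]
    {Λ : Type*} [Fintype Λ] (e : Λ → A) (he : CompleteOrthogonalIdempotents e)
    (hprim : ∀ l, StratAlg.IsPrimitiveIdempotent (e l)) (hbasic : StratAlg.IsBasic e) :
    (∀ _ : LinearOrder Λ, StratAlg.IsProperlyStratified e) ↔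
      ∃ hd : StratAlg.IsDirectedCategory (StratAlg.AssocCat k he),
        Module.Projective A ↥(StratAlg.leftJ hd) ∧
          Module.Projective Aᵐᵒᵖ ↥(StratAlg.rightJ hd) := by
  classical
  constructor
  · intro H
    have hd := StratAlg.isDirectedCategory_of_standard k he hprim hbasic fun L => (H L).1
    exact ⟨hd, StratAlg.projective_leftJ k hprim hd fun L => (H L).1,
      StratAlg.projective_rightJ k hprim hbasic hd fun L => (H L).2⟩
  · rintro ⟨hd, hl, hr⟩ L
    have hnr := StratAlg.noReturn_of_isDirected hd
    have hJ := StratAlg.projective_offDiagPart hd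
    exact ⟨StratAlg.hasFiltrationBy_standardMod k he hprim hnr hJ,
      StratAlg.hasFiltrationBy_properStandardMod k he hprim hbasic hnr hJ
        (StratAlg.projective_offDiagPart_op hd)⟩
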